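/- Let $\mathbb U$ be the open unit disc, $m$ normalized arc length on $\partial\mathbb U$, and $H^p$ ($0<p<\infty$) the Hardy space of holomorphic functions $f$ on $\mathbb U$ with $\|f\|_p=\sup_{0\le r<1}\big(\int_{\partial\mathbb U}|f(r\zeta)|^p\,dm(\zeta)\big)^{1/p}<\infty$. Let $\phi$ be a hyperbolic automorphism of $\mathbb U$ with attractive fixed point $\alpha$, repulsive fixed point $\beta$ and multiplier $\mu>1$; that is, $\phi$ is a holomorphic bijection of $\mathbb U$ onto itself, $\alpha\ne\beta$ lie on $\partial\mathbb U$, and $$\frac{\phi(z)-\beta}{\phi(z)-\alpha}=\mu\,\frac{z-\beta}{z-\alpha}\qquad(z\in\mathbb U).$$ For $n\in\mathbb Z$ let $\phi_n$ be the $n$-th compositional iterate of $\phi$ (iterates of $\phi^{-1}$ for $n<0$), let $C_\phi F=F\circ\phi$ on $H^2$, and for $f\in H^2$ let $D_f$ be the closure in $H^2$ of the linear span of $\{f\circ\phi_n:n\in\mathbb Z\}$. Let $\sigma_p(C_\phi|_{D_f})$ be the set of $\lambda\in\mathbb C$ such that $F\circ\phi=\lambda F$ for some $F\in D_f\setminus\{0\}$.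 Write $A(R_1,R_2)=\{\lambda\in\mathbb C:R_1<|\lambda|<R_2\}$. A set contains an annulus $A$ "except possibly for a discrete subset" if it contains $A\setminus E$ for some $E\subseteq A$ without accumulation points in $A$. Powers and square roots below are holomorphic branches on $\mathbb U$ (the choice does not matter). Then: (a) If $0<\varepsilon,\delta<\tfrac12$ and $f\in (z-\alpha)^{\frac12+\varepsilon}(z-\beta)^{\frac12+\delta}H^2\setminus\{0\}$, then $\sigma_p(C_\phi|_{D_f})$ contains, except possibly for a discrete subset, the open annulus $A(\mu^{-\varepsilon},\mu^{\delta})$. (b) If $f\in\sqrt{(z-\alpha)(z-\beta)}\,H^2\setminus\{0\}$, then $\sigma_p(C_\phi|_{D_f})$ intersects $\partial\mathbb U$ in a set of positive measure; that is, $\sigma_p(C_\phi|_{D_f})\cap\partial\mathbb U$ contains a Borel set $T$ with $m(T)>0$. (c) If $f\in\sqrt{(z-\alpha)(z-\beta)}\,H^p\setminus\{0\}$ for some $2<p<\infty$, then $\sigma_p(C_\phi|_{D_f})$ contains, except possibly for a discrete subset, the open annulus $A(\mu^{-\varepsilon},\mu^{\varepsilon})$ with $\varepsilon=\frac12-\frac1p$.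 -/

import Mathlib

open MeasureTheory Set Filter Topology
open scoped ENNReal Complex.UnitDisc

noncomputable section

/-- Normalized arc-length measure on the unit circle, as a Borel probability measure on `ℂ`. -/
def arcMeasure : Measure ℂ :=
  (ENNReal.ofReal (2 * Real.pi))⁻¹ •
    (volume.restrict (Ioc (0 : ℝ) (2 * Real.pi))).map (circleMap 0 1)

/-- A function on the open unit disc, extended by `0` to the whole plane. -/
def discExt (f : 𝔻 → ℂ) : ℂ → ℂ :=
  Function.extend ((↑) : 𝔻 → ℂ) f 0

/-- Holomorphic functions on the open unit disc. -/
def DiscHolo (f : 𝔻 → ℂ) : Prop :=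
  DifferentiableOn ℂ (discExt f) (Metric.ball 0 1)

/-- The Hardy norm `sup_{0 ≤ r < 1} ‖f(r ·)‖_{L^p(m)}`, where `m` is normalized arc length. -/
def hardyENorm (p : ℝ≥0∞) (f : 𝔻 → ℂ) : ℝ≥0∞ :=
  ⨆ r ∈ Ico (0 : ℝ) 1, eLpNorm (fun ζ : ℂ => discExt f ((r : ℂ) * ζ)) p arcMeasure

/-- Membership in the Hardy space `H^p`. -/
def MemHardy (p : ℝ≥0∞) (f : 𝔻 → ℂ) : Prop :=
  DiscHolo f ∧ hardyENorm p f < ∞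

theorem discExt_coe (f : 𝔻 → ℂ) (z : 𝔻) : discExt f (z : ℂ) = f z :=
  Complex.UnitDisc.coe_injective.extend_apply f 0 z

theorem discExt_of_norm_lt (f : 𝔻 → ℂ) (z : ℂ) (hz : ‖z‖ < 1) :
    discExt f z = f (Complex.UnitDisc.mk z hz) :=
  discExt_coe f (Complex.UnitDisc.mk z hz)

theorem discExt_of_not_norm_lt (f : 𝔻 → ℂ) (z : ℂ) (hz : ¬ ‖z‖ < 1) :
    discExt f z = 0 := by
  refine Function.extend_apply' f (0 : ℂ → ℂ) z ?_
  rintro ⟨w, rfl⟩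
  exact hz w.norm_lt_one

theorem discExt_add (f g : 𝔻 → ℂ) : discExt (f + g) = discExt f + discExt g := by
  funext z
  by_cases hz : ‖z‖ < 1
  · simp [discExt_of_norm_lt _ z hz]
  · simp [discExt_of_not_norm_lt _ z hz]

theorem discExt_smul (c : ℂ) (f : 𝔻 → ℂ) : discExt (c • f) = c • discExt f := by
  funext z
  by_cases hz : ‖z‖ < 1
  · simp [discExt_of_norm_lt _ z hz]
  · simp [discExt_of_not_norm_lt _ z hz]

theorem discExt_zero : discExt (0 : 𝔻 → ℂ) = 0 := by
  simpa using discExt_smul 0 (0 : 𝔻 → ℂ)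

theorem DiscHolo.stronglyMeasurable {f : 𝔻 → ℂ} (hf : DiscHolo f) (r : ℝ) :
    StronglyMeasurable (fun ζ : ℂ => discExt f ((r : ℂ) * ζ)) := by
  classical
  have h : discExt f = (Metric.ball (0 : ℂ) 1).piecewise (discExt f) (fun _ => 0) := by
    funext z
    by_cases hz : z ∈ Metric.ball (0 : ℂ) 1
    · simp [Set.piecewise, hz]
    · rw [Set.piecewise_eq_of_notMem _ _ _ hz]
      exact discExt_of_not_norm_lt f z (by simpa using hz)
  have hm : Measurable (discExt f) := by
    rw [h]
    exact hf.continuousOn.measurable_piecewise continuousOn_const measurableSet_ball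
  exact (hm.comp (measurable_const_mul (r : ℂ))).stronglyMeasurable

theorem hardyENorm_add_le {p : ℝ≥0∞} (hp : 1 ≤ p) {f g : 𝔻 → ℂ} (hf : DiscHolo f)
    (hg : DiscHolo g) : hardyENorm p (f + g) ≤ hardyENorm p f + hardyENorm p g := by
  refine iSup₂_le fun r hr => ?_
  have h : (fun ζ : ℂ => discExt (f + g) ((r : ℂ) * ζ)) =
      (fun ζ : ℂ => discExt f ((r : ℂ) * ζ)) + fun ζ : ℂ => discExt g ((r : ℂ) * ζ) := by
    funext ζ
    simp [discExt_add]
  rw [h]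
  refine (eLpNorm_add_le (hf.stronglyMeasurable r).aestronglyMeasurable
    (hg.stronglyMeasurable r).aestronglyMeasurable hp).trans ?_
  exact add_le_add
    (le_iSup₂ (f := fun (r : ℝ) (_ : r ∈ Ico (0 : ℝ) 1) =>
      eLpNorm (fun ζ : ℂ => discExt f ((r : ℂ) * ζ)) p arcMeasure) r hr)
    (le_iSup₂ (f := fun (r : ℝ) (_ : r ∈ Ico (0 : ℝ) 1) =>
      eLpNorm (fun ζ : ℂ => discExt g ((r : ℂ) * ζ)) p arcMeasure) r hr)

theorem hardyENorm_smul (p : ℝ≥0∞) (c : ℂ) (f : 𝔻 → ℂ) :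
    hardyENorm p (c • f) = ‖c‖ₑ * hardyENorm p f := by
  have h : ∀ r : ℝ, (fun ζ : ℂ => discExt (c • f) ((r : ℂ) * ζ)) =
      c • fun ζ : ℂ => discExt f ((r : ℂ) * ζ) := by
    intro r
    funext ζ
    simp [discExt_smul]
  simp only [hardyENorm, h, eLpNorm_const_smul, ENNReal.mul_iSup]

theorem hardyENorm_zero (p : ℝ≥0∞) : hardyENorm p (0 : 𝔻 → ℂ) = 0 := by
  simpa using hardyENorm_smul p 0 (0 : 𝔻 → ℂ)

theorem eq_zero_of_hardyENorm {p : ℝ≥0∞} (hp : p ≠ 0) {f : 𝔻 → ℂ} (hf : DiscHolo f)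
    (h : hardyENorm p f = 0) : f = 0 := by
  funext z
  have hr : ‖(z : ℂ)‖ ∈ Ico (0 : ℝ) 1 := ⟨norm_nonneg _, z.norm_lt_one⟩
  have h1 : eLpNorm (fun ζ : ℂ => discExt f ((‖(z : ℂ)‖ : ℂ) * ζ)) p arcMeasure = 0 := by
    have := le_iSup₂ (f := fun (r : ℝ) (_ : r ∈ Ico (0 : ℝ) 1) =>
      eLpNorm (fun ζ : ℂ => discExt f ((r : ℂ) * ζ)) p arcMeasure) _ hr
    exact le_antisymm (this.trans h.le) bot_le
  rw [eLpNorm_eq_zero_iff (hf.stronglyMeasurable _).aestronglyMeasurable hp, arcMeasure,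
    Filter.EventuallyEq, Measure.ae_ennreal_smul_measure_iff
      (ENNReal.inv_ne_zero.2 ENNReal.ofReal_ne_top)] at h1
  have h2 := ae_of_ae_map (continuous_circleMap 0 1).aemeasurable h1
  have hc : Continuous fun θ : ℝ => discExt f ((‖(z : ℂ)‖ : ℂ) * circleMap 0 1 θ) := by
    refine hf.continuousOn.comp_continuous (by fun_prop) fun θ => ?_
    simpa [circleMap] using z.norm_lt_one
  have h3 : EqOn (fun θ : ℝ => discExt f ((‖(z : ℂ)‖ : ℂ) * circleMap 0 1 θ)) (fun _ => 0)
      (Ioc (0 : ℝ) (2 * Real.pi)) :=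
    Measure.eqOn_Ioc_of_ae_eq (μ := volume) h2 hc.continuousOn continuousOn_const
  have hz : (z : ℂ) ∈ Metric.sphere (0 : ℂ) |‖(z : ℂ)‖| := by simp
  rw [← image_circleMap_Ioc] at hz
  obtain ⟨θ, hθ, hθz⟩ := hz
  have h4 := h3 hθ
  have h5 : (‖(z : ℂ)‖ : ℂ) * circleMap 0 1 θ = (z : ℂ) := by
    rw [← hθz]
    simp [circleMap]
  simp only [h5] at h4
  rw [discExt_coe] at h4
  exact h4

/-- The Hardy space `H^2` as a linear space of functions on the disc. -/
def hardyTwoSubmodule : Submodule ℂ (𝔻 → ℂ) where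
  carrier := {f | MemHardy 2 f}
  zero_mem' := by
    refine ⟨?_, by simp [hardyENorm_zero]⟩
    rw [DiscHolo, discExt_zero]
    exact differentiableOn_const 0
  add_mem' := by
    intro f g hf hg
    refine ⟨?_, (hardyENorm_add_le (by norm_num) hf.1 hg.1).trans_lt
      (ENNReal.add_lt_top.2 ⟨hf.2, hg.2⟩)⟩
    rw [DiscHolo, discExt_add]
    exact DifferentiableOn.add hf.1 hg.1
  smul_mem' := by
    intro c f hf
    refine ⟨?_, ?_⟩
    · rw [DiscHolo, discExt_smul]
      exact DifferentiableOn.const_smul hf.1 c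
    · rw [hardyENorm_smul]
      exact ENNReal.mul_lt_top enorm_lt_top hf.2

/-- The Hardy space `H^2` of the unit disc; its topology is the one of the Hardy norm (below), not
the topology of pointwise convergence. -/
def HardyTwo : Type := hardyTwoSubmodule

namespace HardyTwo

instance : AddCommGroup HardyTwo := inferInstanceAs (AddCommGroup hardyTwoSubmodule)

instance : Module ℂ HardyTwo := inferInstanceAs (Module ℂ hardyTwoSubmodule)

/-- The underlying function on the disc. -/
def toFun (F : HardyTwo) : 𝔻 → ℂ := Subtype.val F

instance : CoeFun HardyTwo (fun _ => 𝔻 → ℂ) := ⟨toFun⟩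

theorem enorm_ne_top (F : HardyTwo) : hardyENorm 2 (F : 𝔻 → ℂ) ≠ ∞ := F.2.2.ne

instance : Norm HardyTwo := ⟨fun F => (hardyENorm 2 F).toReal⟩

theorem norm_core : NormedSpace.Core ℂ HardyTwo where
  norm_nonneg _ := ENNReal.toReal_nonneg
  norm_smul c F := by
    change (hardyENorm 2 (c • (F : 𝔻 → ℂ))).toReal = ‖c‖ * (hardyENorm 2 F).toReal
    simp [hardyENorm_smul]
  norm_triangle F G := by
    change (hardyENorm 2 ((F : 𝔻 → ℂ) + G)).toReal ≤
      (hardyENorm 2 F).toReal + (hardyENorm 2 G).toReal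
    rw [← ENNReal.toReal_add F.enorm_ne_top G.enorm_ne_top]
    exact ENNReal.toReal_mono (ENNReal.add_ne_top.2 ⟨F.enorm_ne_top, G.enorm_ne_top⟩)
      (hardyENorm_add_le (by norm_num) F.2.1 G.2.1)
  norm_eq_zero_iff F := by
    change (hardyENorm 2 (F : 𝔻 → ℂ)).toReal = 0 ↔ F = 0
    rw [ENNReal.toReal_eq_zero_iff, or_iff_left F.enorm_ne_top]
    constructor
    · intro h
      exact Subtype.ext (eq_zero_of_hardyENorm (by norm_num) F.2.1 h)
    · rintro rfl
      exact hardyENorm_zero 2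

instance : NormedAddCommGroup HardyTwo := NormedAddCommGroup.ofCore norm_core

instance : NormedSpace ℂ HardyTwo := NormedSpace.ofCore norm_core

end HardyTwo

/-- `φ` is a hyperbolic automorphism of the disc with attractive fixed point `α`, repulsive fixed
point `β` and multiplier `μ > 1`: the coordinate change `w = (z - β) / (z - α)`, which takes `β` to
`0` and `α` to `∞`, turns `φ` into the dilation `w ↦ μ w`. -/
structure IsHyperbolicAut (φ : Equiv.Perm 𝔻) (α β : ℂ) (μ : ℝ) : Prop where
  holo : DiscHolo fun z => (φ z : ℂ)
  norm_attractive : ‖α‖ = 1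
  norm_repulsive : ‖β‖ = 1
  fixed_ne : α ≠ β
  one_lt_multiplier : 1 < μ
  conj_dilation : ∀ z : 𝔻,
    ((φ z : ℂ) - β) / ((φ z : ℂ) - α) = (μ : ℂ) * (((z : ℂ) - β) / ((z : ℂ) - α))

/-- The doubly cyclic subspace `D_f`: the closure in `H^2` of the linear span of the functions
`f ∘ φ_n`, `n ∈ ℤ`, where `φ_n = φ ^ n` is the `n`-th compositional iterate. (For an automorphism
`φ` all these functions belong to `H^2`.) -/
def doublyCyclic (φ : Equiv.Perm 𝔻) (f : HardyTwo) : Submodule ℂ HardyTwo :=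
  (Submodule.span ℂ
    {g : HardyTwo | ∃ n : ℤ, (g : 𝔻 → ℂ) = fun z => f ((φ ^ n) z)}).topologicalClosure

/-- The point spectrum of the restriction of the composition operator `C_φ F = F ∘ φ` to `D_f`:
all `c` such that `F ∘ φ = c F` for some nonzero `F ∈ D_f`. -/
def restrictedPointSpectrum (φ : Equiv.Perm 𝔻) (f : HardyTwo) : Set ℂ :=
  {c | ∃ F ∈ doublyCyclic φ f, F ≠ 0 ∧ ∀ z : 𝔻, F (φ z) = c * F z}

/-- `L` is a holomorphic branch of `log (z - a)` on the disc. -/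
def IsLogBranch (a : ℂ) (L : 𝔻 → ℂ) : Prop :=
  DiscHolo L ∧ ∀ z : 𝔻, Complex.exp (L z) = (z : ℂ) - a

/-- `f ∈ (z - α)^s (z - β)^t H^p`. Two branches of a power on the disc differ by a nonzero constant
factor, so the choice of the branches does not matter. -/
def MemPowHardy (p : ℝ≥0∞) (α β : ℂ) (s t : ℝ) (f : 𝔻 → ℂ) : Prop :=
  ∃ A B g : 𝔻 → ℂ, IsLogBranch α A ∧ IsLogBranch β B ∧ MemHardy p g ∧
    ∀ z, f z = Complex.exp (s * A z) * Complex.exp (t * B z) * g z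

/-- `f ∈ √((z - α)(z - β)) H^p`; the two holomorphic branches of the square root on the disc differ
by a sign, so the choice does not matter. -/
def MemSqrtHardy (p : ℝ≥0∞) (α β : ℂ) (f : 𝔻 → ℂ) : Prop :=
  ∃ q g : 𝔻 → ℂ, DiscHolo q ∧ (∀ z : 𝔻, q z ^ 2 = ((z : ℂ) - α) * ((z : ℂ) - β)) ∧
    MemHardy p g ∧ ∀ z, f z = q z * g z

/-- The open annulus `A(R₁, R₂)` centered at the origin. -/
def annulus (R₁ R₂ : ℝ) : Set ℂ := {c | R₁ < ‖c‖ ∧ ‖c‖ < R₂}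

/-- `S` contains `U` except possibly for a discrete subset of `U`, i.e. a subset of `U` that has no
accumulation point in `U`. -/
def ContainsUpToDiscrete (S U : Set ℂ) : Prop :=
  ∃ E ⊆ U, (∀ c ∈ U, ¬ AccPt c (𝓟 E)) ∧ U \ E ⊆ S

end

/-! ### Arc length on the unit circle -/

theorem arcMeasure_lintegral {F : ℂ → ℝ≥0∞} (hF : Measurable F) :
    ∫⁻ ζ, F ζ ∂arcMeasure =
      (ENNReal.ofReal (2 * Real.pi))⁻¹ * ∫⁻ θ in Ioc 0 (2 * Real.pi), F (circleMap 0 1 θ) := by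
  rw [arcMeasure, lintegral_smul_measure, lintegral_map hF (continuous_circleMap 0 1).measurable,
    smul_eq_mul]

theorem arcMeasure_integral {E : Type*} [NormedAddCommGroup E] [NormedSpace ℝ E] {F : ℂ → E}
    (hF : StronglyMeasurable F) : ∫ ζ, F ζ ∂arcMeasure = Real.circleAverage F 0 1 := by
  rw [arcMeasure, integral_smul_measure,
    integral_map (continuous_circleMap 0 1).aemeasurable hF.aestronglyMeasurable,
    Real.circleAverage_def, intervalIntegral.integral_of_le Real.two_pi_pos.le,
    ENNReal.toReal_inv, ENNReal.toReal_ofReal Real.two_pi_pos.le]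

instance isProbabilityMeasure_arcMeasure : IsProbabilityMeasure arcMeasure := by
  constructor
  rw [← lintegral_one, arcMeasure_lintegral measurable_const]
  simp only [lintegral_const, Measure.restrict_apply_univ, Real.volume_Ioc, one_mul, sub_zero]
  exact ENNReal.inv_mul_cancel (by simp [Real.pi_pos]) ENNReal.ofReal_ne_top

theorem ae_norm_eq_one : ∀ᵐ ζ ∂arcMeasure, ‖ζ‖ = 1 := by
  rw [arcMeasure, Measure.ae_ennreal_smul_measure_iff (ENNReal.inv_ne_zero.2 ENNReal.ofReal_ne_top),
    ae_map_iff (continuous_circleMap 0 1).aemeasurable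
      (measurableSet_eq_fun continuous_norm.measurable measurable_const)]
  exact Eventually.of_forall fun θ => by simp [circleMap]

theorem arcMeasure_integral_zpow (n : ℤ) :
    ∫ ζ : ℂ, ζ ^ n ∂arcMeasure = if n = 0 then 1 else 0 := by
  split_ifs with hn
  · simp [hn]
  · have hm : Measurable fun ζ : ℂ => ζ ^ n := by fun_prop
    rw [arcMeasure_integral hm.stronglyMeasurable, Real.circleAverage_eq_circleIntegral one_ne_zero]
    have h : (∮ z in C(0, 1), (z - 0)⁻¹ • (fun ζ : ℂ => ζ ^ n) z) =
        ∮ z in C(0, 1), (z - 0) ^ (n - 1) := by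
      refine circleIntegral.integral_congr zero_le_one fun z hz => ?_
      have hz0 : z ≠ 0 := by
        rintro rfl
        simp at hz
      simp only [sub_zero, smul_eq_mul]
      rw [zpow_sub_one₀ hz0, mul_comm]
    rw [h, circleIntegral.integral_sub_zpow_of_ne (by omega), smul_zero]

theorem integrable_zpow_arcMeasure (n : ℤ) : Integrable (fun ζ : ℂ => ζ ^ n) arcMeasure := by
  have hm : Measurable fun ζ : ℂ => ζ ^ n := by fun_prop
  refine Integrable.of_bound hm.aestronglyMeasurable 1 ?_
  filter_upwards [ae_norm_eq_one] with ζ hζ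
  simp [hζ]

section Orthogonality

variable {E : Type*} [NormedAddCommGroup E]

theorem integral_sum_zpow_smul [NormedSpace ℂ E] [CompleteSpace E] (S : Finset ℤ) (h : ℤ → E)
    (hS : (0 : ℤ) ∈ S) : ∫ ζ : ℂ, ∑ n ∈ S, ζ ^ n • h n ∂arcMeasure = h 0 := by
  rw [integral_finsetSum _ fun n _ => (integrable_zpow_arcMeasure n).smul_const (h n)]
  simp only [integral_smul_const, arcMeasure_integral_zpow, ite_smul, one_smul, zero_smul]
  simp [hS]

/-- Trigonometric monomials are orthonormal, with coefficients in an inner product space. -/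
theorem integral_norm_sq_sum_zpow_smul [InnerProductSpace ℂ E] (S : Finset ℤ) (h : ℤ → E) :
    ∫ ζ : ℂ, ‖∑ n ∈ S, ζ ^ n • h n‖ ^ 2 ∂arcMeasure = ∑ n ∈ S, ‖h n‖ ^ 2 := by
  have hae : ∀ᵐ ζ : ℂ ∂arcMeasure, ((‖∑ n ∈ S, ζ ^ n • h n‖ ^ 2 : ℝ) : ℂ) =
      ∑ n ∈ S, ∑ m ∈ S, ζ ^ (m - n) * inner ℂ (h n) (h m) := by
    filter_upwards [ae_norm_eq_one] with ζ hζ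
    have h0 : ζ ≠ 0 := by
      rintro rfl
      simp at hζ
    have hc : (starRingEnd ℂ) ζ = ζ⁻¹ := by
      rw [Complex.inv_def, Complex.normSq_eq_norm_sq, hζ]
      simp
    have := inner_self_eq_norm_sq_to_K (𝕜 := ℂ) (∑ n ∈ S, ζ ^ n • h n)
    push_cast
    rw [show ((‖∑ n ∈ S, ζ ^ n • h n‖ : ℂ)) ^ 2 = _ from this.symm, sum_inner]
    refine Finset.sum_congr rfl fun n _ => ?_
    rw [inner_sum]
    refine Finset.sum_congr rfl fun m _ => ?_
    rw [inner_smul_left, inner_smul_right, map_zpow₀, hc, inv_zpow, zpow_sub₀ h0]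
    ring
  have hC : ((∫ ζ : ℂ, ‖∑ n ∈ S, ζ ^ n • h n‖ ^ 2 ∂arcMeasure : ℝ) : ℂ) =
      ((∑ n ∈ S, ‖h n‖ ^ 2 : ℝ) : ℂ) := by
    rw [← integral_complex_ofReal, integral_congr_ae hae, integral_finsetSum _ fun n _ =>
      integrable_finsetSum _ fun m _ => (integrable_zpow_arcMeasure (m - n)).mul_const _]
    push_cast
    refine Finset.sum_congr rfl fun n hn => ?_
    rw [integral_finsetSum _ fun m _ => (integrable_zpow_arcMeasure (m - n)).mul_const _]
    simp only [integral_mul_const, arcMeasure_integral_zpow, sub_eq_zero, ite_mul, one_mul,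
      zero_mul]
    rw [Finset.sum_ite_eq' S n, if_pos hn]
    exact inner_self_eq_norm_sq_to_K (𝕜 := ℂ) (h n)
  exact_mod_cast hC

end Orthogonality

/-- Parseval's identity on the unit circle. -/
theorem lintegral_enorm_sq_tsum_pow {a : ℕ → ℂ} (ha : Summable fun n => ‖a n‖) :
    ∫⁻ ζ : ℂ, ‖∑' n, a n * ζ ^ n‖ₑ ^ 2 ∂arcMeasure = ∑' n, ‖a n‖ₑ ^ 2 := by
  have hS : ∀ ζ : ℂ, ‖ζ‖ = 1 → Summable fun n => a n * ζ ^ n := fun ζ hζ =>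
    Summable.of_norm (by simpa [hζ] using ha)
  have hlim : ∀ᵐ ζ : ℂ ∂arcMeasure, Tendsto (fun N => ∑ n ∈ Finset.range N, a n * ζ ^ n) atTop
      (𝓝 (∑' n, a n * ζ ^ n)) := by
    filter_upwards [ae_norm_eq_one] with ζ hζ
    exact (hS ζ hζ).hasSum.tendsto_sum_nat
  have hm : ∀ N, Measurable fun ζ : ℂ => ∑ n ∈ Finset.range N, a n * ζ ^ n := fun N => by fun_prop
  have hpart : ∀ N, ∫ ζ : ℂ, ‖∑ n ∈ Finset.range N, a n * ζ ^ n‖ ^ 2 ∂arcMeasure =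
      ∑ n ∈ Finset.range N, ‖a n‖ ^ 2 := by
    intro N
    have := integral_norm_sq_sum_zpow_smul ((Finset.range N).map Nat.castEmbedding)
      (fun n : ℤ => a n.toNat)
    simpa [Finset.sum_map, mul_comm] using this
  have hbd : ∀ N, ∀ᵐ ζ : ℂ ∂arcMeasure,
      ‖∑ n ∈ Finset.range N, a n * ζ ^ n‖ ≤ ∑' n, ‖a n‖ := by
    intro N
    filter_upwards [ae_norm_eq_one] with ζ hζ
    refine (norm_sum_le _ _).trans ?_
    simpa [hζ] using ha.sum_le_tsum (Finset.range N) fun _ _ => norm_nonneg _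
  have hconv : Tendsto (fun N => ∫⁻ ζ : ℂ, ‖∑ n ∈ Finset.range N, a n * ζ ^ n‖ₑ ^ 2 ∂arcMeasure)
      atTop (𝓝 (∫⁻ ζ : ℂ, ‖∑' n, a n * ζ ^ n‖ₑ ^ 2 ∂arcMeasure)) := by
    refine tendsto_lintegral_of_dominated_convergence
      (fun _ => (ENNReal.ofReal (∑' n, ‖a n‖)) ^ 2) (fun N => ((hm N).enorm.pow_const 2)) ?_ ?_ ?_
    · intro N
      filter_upwards [hbd N] with ζ hζ
      gcongr
      rw [← ofReal_norm]
      exact ENNReal.ofReal_le_ofReal hζ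
    · simp
    · filter_upwards [hlim] with ζ hζ
      exact ((ENNReal.continuous_pow 2).tendsto _).comp ((continuous_enorm.tendsto _).comp hζ)
  have hpart' : ∀ N, ∫⁻ ζ : ℂ, ‖∑ n ∈ Finset.range N, a n * ζ ^ n‖ₑ ^ 2 ∂arcMeasure =
      ∑ n ∈ Finset.range N, ‖a n‖ₑ ^ 2 := by
    intro N
    have h1 : ∀ z : ℂ, ‖z‖ₑ ^ 2 = ENNReal.ofReal (‖z‖ ^ 2) := fun z => by
      rw [← ofReal_norm, ENNReal.ofReal_pow (norm_nonneg _)]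
    simp only [h1]
    rw [← ofReal_integral_eq_lintegral_ofReal, hpart,
      ENNReal.ofReal_sum_of_nonneg fun _ _ => by positivity]
    · refine Integrable.of_bound ((hm N).norm.pow_const 2).aestronglyMeasurable
        ((∑' n, ‖a n‖) ^ 2) ?_
      filter_upwards [hbd N] with ζ hζ
      rw [Real.norm_of_nonneg (by positivity)]
      gcongr
    · exact Eventually.of_forall fun _ => by positivity
  simp only [hpart'] at hconv
  exact tendsto_nhds_unique hconv (ENNReal.tendsto_nat_tsum _)

/-! ### Change of variables under hyperbolic automorphisms on the circle -/

noncomputable section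

/-- The parametrization of the unit circle without `α` by the real line. -/
def circleParam (α : ℂ) (x : ℝ) : ℂ := -α * (1 + x * Complex.I) / (1 - x * Complex.I)

/-- The Möbius transformation fixing `α` and `β` which in the coordinate `(z - β) / (z - α)` is the
dilation by `s`. -/
def hypMap (α β : ℂ) (s : ℝ) (z : ℂ) : ℂ :=
  (α * (s * (z - β)) - β * (z - α)) / (s * (z - β) - (z - α))

/-- The Jacobian on the unit circle of the inverse of `hypMap α β s`. -/
def hypJac (α β : ℂ) (s : ℝ) (z : ℂ) : ℝ :=
  s * ‖α - β‖ ^ 2 / ‖(z - β) - s * (z - α)‖ ^ 2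

end

theorem one_sub_mul_I_ne_zero (x : ℝ) : (1 - x * Complex.I : ℂ) ≠ 0 := fun h => by
  have := congrArg Complex.re h
  simp at this

theorem norm_sq_one_sub_mul_I (x : ℝ) : ‖(1 - x * Complex.I : ℂ)‖ ^ 2 = 1 + x ^ 2 := by
  rw [← Complex.normSq_eq_norm_sq, Complex.normSq_apply]
  simp
  ring

theorem circleParam_eq_exp (α : ℂ) (x : ℝ) :
    circleParam α x = -α * Complex.exp ((2 * Real.arctan x : ℝ) * Complex.I) := by
  have hs : (0 : ℝ) < √(1 + x ^ 2) := by positivity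
  have hs2 : ((√(1 + x ^ 2) : ℝ) : ℂ) ^ 2 = 1 + x ^ 2 := by
    rw [← Complex.ofReal_pow, Real.sq_sqrt (by positivity)]
    push_cast
    ring
  have h1 : Complex.exp ((Real.arctan x : ℝ) * Complex.I) =
      (1 + x * Complex.I) / (√(1 + x ^ 2) : ℝ) := by
    rw [Complex.exp_mul_I, ← Complex.ofReal_cos, ← Complex.ofReal_sin, Real.cos_arctan,
      Real.sin_arctan]
    push_cast
    ring
  have h2 : Complex.exp ((2 * Real.arctan x : ℝ) * Complex.I) =
      (1 + x * Complex.I) ^ 2 / (1 + x ^ 2) := by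
    rw [show (((2 * Real.arctan x : ℝ) : ℂ) * Complex.I) =
      (Real.arctan x : ℝ) * Complex.I + (Real.arctan x : ℝ) * Complex.I by push_cast; ring,
      Complex.exp_add, h1, div_mul_div_comm, ← sq, ← sq, hs2]
  have h3 : (1 + x ^ 2 : ℂ) = (1 + x * Complex.I) * (1 - x * Complex.I) := by
    ring_nf
    simp
  have h4 : (1 + x * Complex.I : ℂ) ≠ 0 := by
    simpa using one_sub_mul_I_ne_zero (-x)
  have h5 := one_sub_mul_I_ne_zero x
  rw [h2, h3, circleParam]
  field_simp

theorem exists_circleParam_eq {α β : ℂ} (hα : ‖α‖ = 1) (hβ : ‖β‖ = 1) (h : α ≠ β) :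
    ∃ x, circleParam α x = β := by
  have hα0 : α ≠ 0 := by
    rintro rfl
    simp at hα
  set u : ℂ := -β / α with hu
  have hun : ‖u‖ = 1 := by simp [hu, hα, hβ]
  have hne : Complex.arg u ≠ Real.pi := by
    intro hpi
    have := Complex.norm_mul_exp_arg_mul_I u
    rw [hun, hpi, Complex.exp_pi_mul_I] at this
    rw [hu] at this
    field_simp at this
    push_cast at this
    apply h
    linear_combination -this
  have hlt := lt_of_le_of_ne (Complex.arg_le_pi u) hne
  refine ⟨Real.tan (Complex.arg u / 2), ?_⟩
  rw [circleParam_eq_exp, Real.arctan_tan (by linarith [Complex.neg_pi_lt_arg u]) (by linarith),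
    mul_div_cancel₀ _ two_ne_zero]
  have := Complex.norm_mul_exp_arg_mul_I u
  rw [hun] at this
  push_cast at this
  rw [one_mul] at this
  rw [this, hu]
  field_simp

theorem arcMeasure_lintegral_eq_param {α : ℂ} (hα : ‖α‖ = 1) {F : ℂ → ℝ≥0∞} (hF : Measurable F) :
    ∫⁻ ζ, F ζ ∂arcMeasure =
      ∫⁻ x : ℝ, ENNReal.ofReal (1 / (Real.pi * (1 + x ^ 2))) * F (circleParam α x) := by
  have hpi := Real.pi_pos
  set η := Complex.arg (-α) with hη
  have hαη : -α = Complex.exp (η * Complex.I) := by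
    have := Complex.norm_mul_exp_arg_mul_I (-α)
    rw [norm_neg, hα] at this
    simpa using this.symm
  set G : ℝ → ℝ≥0∞ := fun θ => F (circleMap 0 1 θ) with hG
  have hper : ∫⁻ θ in Ioc 0 (0 + 2 * Real.pi), G θ =
      ∫⁻ θ in Ioc (η - Real.pi) (η - Real.pi + 2 * Real.pi), G θ := by
    refine (isAddFundamentalDomain_Ioc Real.two_pi_pos 0 volume).setLIntegral_eq
      (isAddFundamentalDomain_Ioc Real.two_pi_pos (η - Real.pi) volume) G ?_
    rintro ⟨g, hg⟩ θ
    obtain ⟨k, rfl⟩ := AddSubgroup.mem_zmultiples_iff.1 hg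
    change G (k • (2 * Real.pi) + θ) = G θ
    have : Function.Periodic G (2 * Real.pi) := fun θ => by
      simp only [hG, periodic_circleMap 0 1 θ]
    rw [add_comm]
    exact this.zsmul k θ
  have hshift : ∫⁻ θ in Ioc (η - Real.pi) (η - Real.pi + 2 * Real.pi), G θ =
      ∫⁻ θ in Ioc (-Real.pi) Real.pi, G (θ + η) := by
    have h := (measurePreserving_add_right volume η).setLIntegral_comp_preimage_emb
      (measurableEmbedding_addRight η) G (Ioc (η - Real.pi) (η - Real.pi + 2 * Real.pi))
    rw [← h]
    congr 2
    rw [preimage_add_const_Ioc]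
    congr 1 <;> ring
  have himg : (fun x => 2 * Real.arctan x) '' univ = Ioo (-Real.pi) Real.pi := by
    have : (fun x => 2 * Real.arctan x) = (fun y => 2 * y) ∘ Real.arctan := rfl
    rw [this, image_comp, image_univ, Real.range_arctan, image_mul_left_Ioo two_pos]
    congr 1 <;> ring
  have hsub : ∫⁻ θ in Ioo (-Real.pi) Real.pi, G (θ + η) =
      ∫⁻ x : ℝ, ENNReal.ofReal |2 * (1 / (1 + x ^ 2))| * G (2 * Real.arctan x + η) := by
    rw [← himg, lintegral_image_eq_lintegral_abs_deriv_mul MeasurableSet.univ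
      (fun x _ => ((Real.hasDerivAt_arctan x).const_mul 2).hasDerivWithinAt)
      (fun x _ y _ hxy => Real.arctan_injective (by simpa using hxy)), Measure.restrict_univ]
  rw [arcMeasure_lintegral hF, ← zero_add (2 * Real.pi), hper, hshift,
    Measure.restrict_congr_set Ioo_ae_eq_Ioc.symm, hsub, zero_add,
    ← lintegral_const_mul' _ _ (ENNReal.inv_ne_top.2 (by simp [Real.pi_pos]))]
  refine lintegral_congr fun x => ?_
  rw [← mul_assoc, ← ENNReal.ofReal_inv_of_pos Real.two_pi_pos,
    ← ENNReal.ofReal_mul (by positivity), abs_of_pos (by positivity)]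
  congr 2
  · field_simp
  · rw [circleParam_eq_exp, hαη, ← Complex.exp_add]
    simp only [hG, circleMap]
    push_cast
    rw [zero_add, one_mul]
    congr 1
    ring_nf

theorem circleParam_sub_self (α : ℂ) (x : ℝ) :
    circleParam α x - α = -2 * α / (1 - x * Complex.I) := by
  have := one_sub_mul_I_ne_zero x
  rw [circleParam]
  field_simp
  ring

theorem circleParam_sub_circleParam (α : ℂ) (x y : ℝ) :
    circleParam α x - circleParam α y =
      -2 * α * ((x - y) * Complex.I) / ((1 - x * Complex.I) * (1 - y * Complex.I)) := by
  have hx := one_sub_mul_I_ne_zero x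
  have hy := one_sub_mul_I_ne_zero y
  rw [circleParam, circleParam, div_sub_div _ _ hx hy]
  congr 1
  ring

theorem hypMap_circleParam {α : ℂ} (hα : α ≠ 0) (s x y : ℝ) :
    hypMap α (circleParam α y) s (circleParam α x) = circleParam α (y + s * (x - y)) := by
  have h1 := one_sub_mul_I_ne_zero x
  have h2 := one_sub_mul_I_ne_zero y
  have h3 := one_sub_mul_I_ne_zero (y + s * (x - y))
  have hd : s * (circleParam α x - circleParam α y) - (circleParam α x - α) =
      2 * α * (1 - (y + s * (x - y) : ℝ) * Complex.I) /
        ((1 - x * Complex.I) * (1 - y * Complex.I)) := by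
    rw [circleParam_sub_circleParam, circleParam_sub_self]
    field_simp
    push_cast
    ring
  rw [hypMap, hd, circleParam_sub_circleParam, circleParam_sub_self]
  simp only [circleParam]
  field_simp
  push_cast
  ring

theorem hypJac_circleParam {α : ℂ} (hα : ‖α‖ = 1) {s : ℝ} (hs : 0 < s) (x y : ℝ) :
    hypJac α (circleParam α y) s (circleParam α x) =
      s⁻¹ * ((1 + x ^ 2) / (1 + (y + (x - y) / s) ^ 2)) := by
  have h1 := one_sub_mul_I_ne_zero x
  have h2 := one_sub_mul_I_ne_zero y
  have hd : (circleParam α x - circleParam α y) - s * (circleParam α x - α) =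
      2 * α * s * (1 - (y + (x - y) / s : ℝ) * Complex.I) /
        ((1 - x * Complex.I) * (1 - y * Complex.I)) := by
    have : (s : ℂ) ≠ 0 := by exact_mod_cast hs.ne'
    rw [circleParam_sub_circleParam, circleParam_sub_self]
    field_simp
    push_cast
    field_simp
    ring
  have hsn : ‖(s : ℂ)‖ = s := by simp [hs.le]
  rw [hypJac, hd, norm_sub_rev, circleParam_sub_self]
  simp only [norm_div, norm_mul, norm_neg, div_pow, mul_pow, hα, hsn, norm_sq_one_sub_mul_I]
  have : 0 < 1 + (y + (x - y) / s) ^ 2 := by positivity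
  simp only [RCLike.norm_ofNat]
  field_simp

theorem measurable_hypMap (α β : ℂ) (s : ℝ) : Measurable (hypMap α β s) := by
  unfold hypMap
  fun_prop

theorem measurable_hypJac (α β : ℂ) (s : ℝ) : Measurable (hypJac α β s) := by
  unfold hypJac
  fun_prop

theorem lintegral_comp_hypMap {α β : ℂ} (hα : ‖α‖ = 1) (hβ : ‖β‖ = 1) (h : α ≠ β) {s : ℝ}
    (hs : 0 < s) {F : ℂ → ℝ≥0∞} (hF : Measurable F) :
    ∫⁻ ζ, F (hypMap α β s ζ) ∂arcMeasure =
      ∫⁻ ζ, ENNReal.ofReal (hypJac α β s ζ) * F ζ ∂arcMeasure := by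
  obtain ⟨y, rfl⟩ := exists_circleParam_eq hα hβ h
  have hα0 : α ≠ 0 := by
    rintro rfl
    simp at hα
  have himg : (fun x : ℝ => y + (x - y) / s) '' univ = univ := by
    rw [image_univ, Function.Surjective.range_eq]
    intro x
    exact ⟨y + s * (x - y), by field_simp; ring⟩
  rw [arcMeasure_lintegral_eq_param (F := fun ζ => F (hypMap α (circleParam α y) s ζ)) hα
      (hF.comp (measurable_hypMap _ _ _)),
    arcMeasure_lintegral_eq_param
      (F := fun ζ => ENNReal.ofReal (hypJac α (circleParam α y) s ζ) * F ζ) hα ((measurable_hypJac _ _ _).ennreal_ofReal.mul hF),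
    ← setLIntegral_univ, ← himg,
    lintegral_image_eq_lintegral_abs_deriv_mul (f := fun x => y + (x - y) / s)
      (f' := fun _ => 1 / s) MeasurableSet.univ
      (fun x _ => ((((hasDerivAt_id x).sub_const y).div_const s).const_add y).hasDerivWithinAt)
      (fun a _ b _ hab => by
        have := hs.ne'
        field_simp at hab
        linarith), setLIntegral_univ]
  refine lintegral_congr fun x => ?_
  rw [hypMap_circleParam hα0, hypJac_circleParam hα hs, ← mul_assoc, ← mul_assoc,
    ← ENNReal.ofReal_mul (by positivity), ← ENNReal.ofReal_mul (by positivity),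
    abs_of_pos (by positivity)]
  have hpi := Real.pi_pos
  congr 2
  · have : 0 < 1 + (y + (x - y) / s) ^ 2 := by positivity
    field_simp
  · congr 1
    field_simp
    ring

/-! ### Power series and the Hardy space `H^2` -/

theorem DiscHolo.of_eq {f : 𝔻 → ℂ} {F : ℂ → ℂ} (hF : DifferentiableOn ℂ F (Metric.ball 0 1))
    (h : ∀ z : 𝔻, f z = F z) : DiscHolo f := by
  refine hF.congr fun z hz => ?_
  rw [discExt_of_norm_lt f z (by simpa using hz), h]
  rfl

theorem DiscHolo.hasSum {f : 𝔻 → ℂ} (hf : DiscHolo f) :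
    ∃ a : ℕ → ℂ, ∀ z : ℂ, ‖z‖ < 1 → HasSum (fun n => a n * z ^ n) (discExt f z) := by
  refine ⟨fun n => (n.factorial : ℂ)⁻¹ * iteratedDeriv n (discExt f) 0, fun z hz => ?_⟩
  have := Complex.hasSum_taylorSeries_on_ball (f := discExt f) (c := 0) (r := 1) hf
    (z := z) (by simpa using hz)
  refine this.congr_fun fun n => ?_
  simp
  ring

theorem summable_norm_mul_pow_of_hasSum {a : ℕ → ℂ} {F : ℂ → ℂ}
    (h : ∀ z : ℂ, ‖z‖ < 1 → HasSum (fun n => a n * z ^ n) (F z)) {r : ℝ} (hr : r ∈ Ico (0 : ℝ) 1) :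
    Summable fun n => ‖a n * (r : ℂ) ^ n‖ :=
  (h r (by simpa [abs_of_nonneg hr.1] using hr.2)).summable.norm

theorem lintegral_enorm_sq_circle {a : ℕ → ℂ} {F : ℂ → ℂ}
    (h : ∀ z : ℂ, ‖z‖ < 1 → HasSum (fun n => a n * z ^ n) (F z)) {r : ℝ} (hr : r ∈ Ico (0 : ℝ) 1) :
    ∫⁻ ζ : ℂ, ‖F (r * ζ)‖ₑ ^ 2 ∂arcMeasure = ∑' n, ‖a n‖ₑ ^ 2 * ENNReal.ofReal r ^ (2 * n) := by
  have h1 : ∀ᵐ ζ : ℂ ∂arcMeasure,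
      ‖F (r * ζ)‖ₑ ^ 2 = ‖∑' n, (a n * (r : ℂ) ^ n) * ζ ^ n‖ₑ ^ 2 := by
    filter_upwards [ae_norm_eq_one] with ζ hζ
    rw [← (h (r * ζ) (by simpa [hζ, abs_of_nonneg hr.1] using hr.2)).tsum_eq]
    simp only [mul_pow, mul_assoc]
  rw [lintegral_congr_ae h1, lintegral_enorm_sq_tsum_pow (summable_norm_mul_pow_of_hasSum h hr)]
  refine tsum_congr fun n => ?_
  rw [enorm_mul, enorm_pow, mul_pow, ← pow_mul, mul_comm n 2, ← ofReal_norm (r : ℂ)]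
  simp [abs_of_nonneg hr.1]

theorem eLpNorm_two_sq {α E : Type*} [MeasurableSpace α] [NormedAddCommGroup E] (F : α → E)
    (m : Measure α) : eLpNorm F 2 m ^ 2 = ∫⁻ x, ‖F x‖ₑ ^ 2 ∂m := by
  rw [eLpNorm_eq_lintegral_rpow_enorm_toReal two_ne_zero ENNReal.ofNat_ne_top,
    ← ENNReal.rpow_natCast, ← ENNReal.rpow_mul]
  simp

theorem hardyENorm_two_sq (f : 𝔻 → ℂ) : hardyENorm 2 f ^ 2 =
    ⨆ r ∈ Ico (0 : ℝ) 1, ∫⁻ ζ : ℂ, ‖discExt f (r * ζ)‖ₑ ^ 2 ∂arcMeasure := by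
  have h := (ENNReal.orderIsoRpow 2 two_pos).map_iSup₂
    fun (r : ℝ) (_ : r ∈ Ico (0 : ℝ) 1) =>
      eLpNorm (fun ζ : ℂ => discExt f ((r : ℂ) * ζ)) 2 arcMeasure
  simp only [ENNReal.orderIsoRpow_apply] at h
  rw [hardyENorm, ← ENNReal.rpow_two, h]
  simp only [ENNReal.rpow_two, eLpNorm_two_sq]

theorem lintegral_le_hardyENorm_sq (f : 𝔻 → ℂ) {r : ℝ} (hr : r ∈ Ico (0 : ℝ) 1) :
    ∫⁻ ζ : ℂ, ‖discExt f (r * ζ)‖ₑ ^ 2 ∂arcMeasure ≤ hardyENorm 2 f ^ 2 := by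
  rw [hardyENorm_two_sq]
  exact le_iSup₂ (f := fun (r : ℝ) (_ : r ∈ Ico (0 : ℝ) 1) =>
    ∫⁻ ζ : ℂ, ‖discExt f (r * ζ)‖ₑ ^ 2 ∂arcMeasure) r hr

theorem lintegral_circle_mono {f : 𝔻 → ℂ} (hf : DiscHolo f) {r s : ℝ} (hr : 0 ≤ r) (hrs : r ≤ s)
    (hs : s < 1) : ∫⁻ ζ : ℂ, ‖discExt f (r * ζ)‖ₑ ^ 2 ∂arcMeasure ≤
      ∫⁻ ζ : ℂ, ‖discExt f (s * ζ)‖ₑ ^ 2 ∂arcMeasure := by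
  obtain ⟨a, ha⟩ := hf.hasSum
  rw [lintegral_enorm_sq_circle ha ⟨hr, hrs.trans_lt hs⟩,
    lintegral_enorm_sq_circle ha ⟨hr.trans hrs, hs⟩]
  gcongr

theorem hardyENorm_sq_eq_tsum {f : 𝔻 → ℂ} {a : ℕ → ℂ}
    (h : ∀ z : ℂ, ‖z‖ < 1 → HasSum (fun n => a n * z ^ n) (discExt f z)) :
    hardyENorm 2 f ^ 2 = ∑' n, ‖a n‖ₑ ^ 2 := by
  rw [hardyENorm_two_sq]
  refine le_antisymm (iSup₂_le fun r hr => ?_) ?_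
  · rw [lintegral_enorm_sq_circle h hr]
    refine ENNReal.tsum_le_tsum fun n => mul_le_of_le_one_right' (pow_le_one' ?_ _)
    exact ENNReal.ofReal_le_one.2 hr.2.le
  · rw [ENNReal.tsum_eq_iSup_sum]
    refine iSup_le fun S => ?_
    have ht : Tendsto (fun r : ℝ => ∑ n ∈ S, ‖a n‖ₑ ^ 2 * ENNReal.ofReal r ^ (2 * n)) (𝓝[<] 1)
        (𝓝 (∑ n ∈ S, ‖a n‖ₑ ^ 2 * ENNReal.ofReal 1 ^ (2 * n))) := by
      refine tendsto_finsetSum _ fun n _ => ?_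
      refine ENNReal.Tendsto.const_mul ?_ (Or.inr (by simp))
      exact ((ENNReal.continuous_pow _).comp ENNReal.continuous_ofReal).continuousWithinAt
    simp only [ENNReal.ofReal_one, one_pow, mul_one] at ht
    refine le_of_tendsto ht ?_
    have hev : ∀ᶠ r : ℝ in 𝓝[<] 1, r ∈ Ico (0 : ℝ) 1 := Ico_mem_nhdsLT zero_lt_one
    filter_upwards [hev] with r hr
    refine le_trans ?_ (le_iSup₂ (f := fun (r : ℝ) (_ : r ∈ Ico (0 : ℝ) 1) =>
      ∫⁻ ζ : ℂ, ‖discExt f (r * ζ)‖ₑ ^ 2 ∂arcMeasure) r hr)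
    rw [lintegral_enorm_sq_circle h hr]
    exact ENNReal.sum_le_tsum S

/-- If `|h|²` extends continuously to the closed disc, then the Hardy norm of `h` is bounded by the
`L²` norm of the boundary values. -/
theorem hardyENorm_sq_le_lintegral {h : 𝔻 → ℂ} (hh : DiscHolo h) {u : ℂ → ℝ}
    (hu : ContinuousOn u (Metric.closedBall 0 1)) (hhu : ∀ z : 𝔻, ‖h z‖ ^ 2 = u z) :
    hardyENorm 2 h ^ 2 ≤ ∫⁻ ζ, ENNReal.ofReal (u ζ) ∂arcMeasure := by
  rw [hardyENorm_two_sq]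
  refine iSup₂_le fun r hr => ?_
  obtain ⟨C, hC⟩ := (isCompact_closedBall (0 : ℂ) 1).exists_bound_of_continuousOn hu
  have hnorm : ∀ z : ℂ, ‖z‖ < 1 → ‖discExt h z‖ₑ ^ 2 = ENNReal.ofReal (u z) := by
    intro z hz
    rw [discExt_of_norm_lt h z hz, ← ofReal_norm, ← ENNReal.ofReal_pow (norm_nonneg _), hhu]
    rfl
  have hev : ∀ᶠ s : ℝ in 𝓝[<] 1, s ∈ Ico r 1 := Ico_mem_nhdsLT hr.2
  have ht : Tendsto (fun s : ℝ => ∫⁻ ζ : ℂ, ‖discExt h (s * ζ)‖ₑ ^ 2 ∂arcMeasure) (𝓝[<] 1)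
      (𝓝 (∫⁻ ζ, ENNReal.ofReal (u ζ) ∂arcMeasure)) := by
    refine tendsto_lintegral_filter_of_dominated_convergence (fun _ => ENNReal.ofReal C) ?_ ?_ ?_ ?_
    · exact Eventually.of_forall fun s => ((hh.stronglyMeasurable s).measurable.enorm.pow_const 2)
    · filter_upwards [hev] with s hs
      filter_upwards [ae_norm_eq_one] with ζ hζ
      have hsz : ‖(s : ℂ) * ζ‖ < 1 := by
        simpa [hζ, abs_of_nonneg (hr.1.trans hs.1)] using hs.2
      rw [hnorm _ hsz]
      exact ENNReal.ofReal_le_ofReal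
        ((le_abs_self _).trans (hC _ (by simpa using hsz.le)))
    · simp
    · filter_upwards [ae_norm_eq_one] with ζ hζ
      have h1 : Tendsto (fun s : ℝ => (s : ℂ) * ζ) (𝓝[<] 1) (𝓝[Metric.closedBall 0 1] ζ) := by
        refine tendsto_nhdsWithin_iff.2 ⟨?_, ?_⟩
        · have : Continuous fun s : ℝ => (s : ℂ) * ζ := by fun_prop
          simpa using (this.tendsto 1).mono_left (nhdsWithin_le_nhds (s := Iio 1))
        · filter_upwards [hev] with s hs
          simpa [hζ, abs_of_nonneg (hr.1.trans hs.1)] using hs.2.le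
      have h2 := (hu ζ (by simp [hζ])).tendsto.comp h1
      refine (ENNReal.tendsto_ofReal h2).congr' ?_
      filter_upwards [hev] with s hs
      rw [hnorm _ (by simpa [hζ, abs_of_nonneg (hr.1.trans hs.1)] using hs.2)]
      rfl
  refine ge_of_tendsto ht ?_
  filter_upwards [hev] with s hs
  exact lintegral_circle_mono hh hr.1 hs.1 hs.2

/-! ### `H^2` as a sequence space -/

theorem summable_norm_mul_pow_of_summable_norm_sq {a : ℕ → ℂ} (ha : Summable fun n => ‖a n‖ ^ 2) {z : ℂ}
    (hz : ‖z‖ < 1) : Summable fun n => ‖a n‖ * ‖z‖ ^ n := by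
  have h2 : Summable fun n => (‖z‖ ^ n) ^ 2 := by
    simp only [← pow_mul, mul_comm _ 2]
    simp only [pow_mul]
    exact summable_geometric_of_lt_one (by positivity) (by nlinarith [norm_nonneg z])
  refine Summable.of_nonneg_of_le (fun n => by positivity) (fun n => ?_) (ha.add h2)
  nlinarith [sq_nonneg (‖a n‖ - ‖z‖ ^ n), norm_nonneg (a n), pow_nonneg (norm_nonneg z) n]

theorem differentiableOn_tsum_pow {a : ℕ → ℂ} (ha : Summable fun n => ‖a n‖ ^ 2) :
    DifferentiableOn ℂ (fun z => ∑' n, a n * z ^ n) (Metric.ball 0 1) := by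
  intro z hz
  have hz1 : ‖z‖ < 1 := by simpa using hz
  obtain ⟨r, hzr, hr1⟩ := exists_between hz1
  have hr0 : 0 ≤ r := (norm_nonneg z).trans hzr.le
  have hs := summable_norm_mul_pow_of_summable_norm_sq ha (z := (r : ℂ)) (by simpa [abs_of_nonneg hr0] using hr1)
  have hd : DifferentiableOn ℂ (fun z => ∑' n, a n * z ^ n) (Metric.ball 0 r) := by
    refine Complex.differentiableOn_tsum_of_summable_norm hs (fun n => by fun_prop) Metric.isOpen_ball ?_
    intro n w hw
    have : ‖w‖ < r := by simpa using hw
    rw [norm_mul, norm_pow]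
    simp only [Complex.norm_real, Real.norm_of_nonneg hr0]
    gcongr
  exact (hd.differentiableAt (Metric.isOpen_ball.mem_nhds (by simpa using hzr))).differentiableWithinAt

theorem discExt_tsum_pow {a : ℕ → ℂ} {z : ℂ} (hz : ‖z‖ < 1) :
    discExt (fun w : 𝔻 => ∑' n, a n * (w : ℂ) ^ n) z = ∑' n, a n * z ^ n := by
  rw [discExt_of_norm_lt _ z hz]
  rfl

theorem hasSum_discExt_tsum_pow {a : ℕ → ℂ} (ha : Summable fun n => ‖a n‖ ^ 2) {z : ℂ}
    (hz : ‖z‖ < 1) :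
    HasSum (fun n => a n * z ^ n) (discExt (fun w : 𝔻 => ∑' n, a n * (w : ℂ) ^ n) z) := by
  rw [discExt_tsum_pow hz]
  refine (Summable.of_norm ?_).hasSum
  simpa using summable_norm_mul_pow_of_summable_norm_sq ha hz

theorem tsum_enorm_sq_eq {a : ℕ → ℂ} (ha : Summable fun n => ‖a n‖ ^ 2) :
    ∑' n, ‖a n‖ₑ ^ 2 = ENNReal.ofReal (∑' n, ‖a n‖ ^ 2) := by
  rw [ENNReal.ofReal_tsum_of_nonneg (fun n => by positivity) ha]
  refine tsum_congr fun n => ?_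
  rw [← ofReal_norm, ENNReal.ofReal_pow (norm_nonneg _)]

theorem summable_norm_sq_of_tsum_ne_top {a : ℕ → ℂ} (ha : ∑' n, ‖a n‖ₑ ^ 2 ≠ ∞) :
    Summable fun n => ‖a n‖ ^ 2 := by
  have := ENNReal.summable_toReal ha
  simpa using this

theorem memHardy_tsum_pow {a : ℕ → ℂ} (ha : Summable fun n => ‖a n‖ ^ 2) :
    MemHardy 2 fun w : 𝔻 => ∑' n, a n * (w : ℂ) ^ n := by
  refine ⟨DiscHolo.of_eq (differentiableOn_tsum_pow ha) fun _ => rfl, ?_⟩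
  have := hardyENorm_sq_eq_tsum fun z hz => hasSum_discExt_tsum_pow ha (z := z) hz
  rw [tsum_enorm_sq_eq ha] at this
  by_contra htop
  rw [not_lt, top_le_iff] at htop
  rw [htop] at this
  simp at this

theorem HardyTwo.ext {F G : HardyTwo} (h : ∀ z : 𝔻, F z = G z) : F = G :=
  Subtype.ext (funext h)

theorem HardyTwo.smul_apply (c : ℂ) (F : HardyTwo) (z : 𝔻) : (c • F) z = c * F z := rfl

theorem HardyTwo.enorm_eq (F : HardyTwo) : ‖F‖ₑ = hardyENorm 2 (F : 𝔻 → ℂ) := by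
  rw [← ofReal_norm]
  exact ENNReal.ofReal_toReal F.enorm_ne_top

theorem lp_two_summable (a : lp (fun _ : ℕ => ℂ) 2) : Summable fun n => ‖a n‖ ^ 2 := by
  simpa using (lp.memℓp a).summable (by norm_num)

noncomputable section

/-- The power series with square-summable coefficients, as elements of `H^2`. -/
def hardyOfSeq : lp (fun _ : ℕ => ℂ) 2 →ₗᵢ[ℂ] HardyTwo where
  toFun a := ⟨fun w => ∑' n, a n * (w : ℂ) ^ n, memHardy_tsum_pow (lp_two_summable a)⟩
  map_add' a b := by
    refine HardyTwo.ext fun z => ?_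
    have hs : ∀ a : lp (fun _ : ℕ => ℂ) 2, Summable fun n => a n * (z : ℂ) ^ n := fun a =>
      (hasSum_discExt_tsum_pow (lp_two_summable a) z.norm_lt_one).summable
    change ∑' n, (a n + b n) * (z : ℂ) ^ n = (∑' n, a n * (z : ℂ) ^ n) + ∑' n, b n * (z : ℂ) ^ n
    simp only [add_mul, (hs a).tsum_add (hs b)]
  map_smul' c a := by
    refine HardyTwo.ext fun z => ?_
    change ∑' n, (c * a n) * (z : ℂ) ^ n = c * ∑' n, a n * (z : ℂ) ^ n
    simp only [mul_assoc, tsum_mul_left]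
  norm_map' a := by
    change (hardyENorm 2 fun w : 𝔻 => ∑' n, a n * (w : ℂ) ^ n).toReal = ‖a‖
    have h := hardyENorm_sq_eq_tsum fun z hz => hasSum_discExt_tsum_pow (lp_two_summable a)
      (z := z) hz
    rw [tsum_enorm_sq_eq (lp_two_summable a)] at h
    have h1 : (hardyENorm 2 fun w : 𝔻 => ∑' n, a n * (w : ℂ) ^ n).toReal ^ 2 = ‖a‖ ^ 2 := by
      rw [← ENNReal.toReal_pow, h, ENNReal.toReal_ofReal (tsum_nonneg fun n => by positivity)]
      have := lp.norm_rpow_eq_tsum (p := 2) (by norm_num) a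
      simpa using this.symm
    exact (sq_eq_sq₀ ENNReal.toReal_nonneg (norm_nonneg _)).1 h1

theorem hardyOfSeq_surjective : Function.Surjective hardyOfSeq := by
  intro F
  obtain ⟨a, ha⟩ := F.2.1.hasSum
  have hne : ∑' n, ‖a n‖ₑ ^ 2 ≠ ∞ := by
    rw [← hardyENorm_sq_eq_tsum ha]
    exact ENNReal.pow_ne_top F.enorm_ne_top
  have hs := summable_norm_sq_of_tsum_ne_top hne
  refine ⟨⟨a, memℓp_gen (by simpa using hs)⟩, HardyTwo.ext fun z => ?_⟩
  change ∑' n, a n * (z : ℂ) ^ n = F z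
  rw [(ha z z.norm_lt_one).tsum_eq]
  exact discExt_coe _ z

instance : CompleteSpace HardyTwo :=
  (hardyOfSeq.isometry.isUniformInducing.completeSpace_congr hardyOfSeq_surjective).1 inferInstance

/-- Point evaluation on `H^2`. -/
def hardyEval (z : 𝔻) : HardyTwo →L[ℂ] ℂ :=
  LinearMap.mkContinuous
    { toFun := fun F => F z
      map_add' := fun _ _ => rfl
      map_smul' := fun _ _ => rfl } (∑' n, ‖(z : ℂ)‖ ^ n) (by
    intro F
    obtain ⟨a, rfl⟩ := hardyOfSeq_surjective F
    rw [hardyOfSeq.norm_map]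
    change ‖∑' n, a n * (z : ℂ) ^ n‖ ≤ (∑' n, ‖(z : ℂ)‖ ^ n) * ‖a‖
    have hg : Summable fun n => ‖(z : ℂ)‖ ^ n :=
      summable_geometric_of_lt_one (norm_nonneg _) z.norm_lt_one
    refine tsum_of_norm_bounded (hg.hasSum.mul_right ‖a‖) fun n => ?_
    rw [norm_mul, norm_pow, mul_comm]
    gcongr
    exact lp.norm_apply_le_norm (by norm_num) a n)

theorem hardyEval_apply (z : 𝔻) (F : HardyTwo) : hardyEval z F = F z := rfl

end

/-! ### Iterates of a hyperbolic automorphism -/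

theorem DiscHolo.comp {f : 𝔻 → ℂ} (hf : DiscHolo f) {ψ : 𝔻 → 𝔻} {Ψ : ℂ → ℂ}
    (hΨ : DifferentiableOn ℂ Ψ (Metric.ball 0 1)) (h : ∀ z : 𝔻, (ψ z : ℂ) = Ψ z) :
    DiscHolo fun z => f (ψ z) := by
  have hmaps : MapsTo Ψ (Metric.ball 0 1) (Metric.ball 0 1) := by
    intro z hz
    have := h (Complex.UnitDisc.mk z (by simpa using hz))
    rw [Complex.UnitDisc.coe_mk] at this
    rw [← this]
    simpa using (ψ _).norm_lt_one
  refine DiscHolo.of_eq (DifferentiableOn.comp hf hΨ hmaps) fun z => ?_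
  rw [Function.comp_apply, ← h, discExt_coe]

theorem DiscHolo.mul {f g : 𝔻 → ℂ} (hf : DiscHolo f) (hg : DiscHolo g) :
    DiscHolo fun z => f z * g z :=
  DiscHolo.of_eq (DifferentiableOn.mul hf hg) fun z => by simp [discExt_coe]

theorem coe_ne_of_norm_eq_one {a : ℂ} (ha : ‖a‖ = 1) (z : 𝔻) : (z : ℂ) - a ≠ 0 := by
  intro h
  have := z.norm_lt_one
  rw [sub_eq_zero.1 h, ha] at this
  exact lt_irrefl _ this

theorem hypMap_denom_ne_zero {α β : ℂ} (hα : ‖α‖ = 1) (hβ : ‖β‖ = 1) (h : α ≠ β) {s : ℝ}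
    (hs : 0 < s) {z : ℂ} (hz : ‖z‖ ≤ 1) : s * (z - β) - (z - α) ≠ 0 := by
  intro h0
  have h1 : ((s - 1 : ℝ) : ℂ) * z = s * β - α := by
    push_cast
    linear_combination h0
  have h2 : (s - 1) ^ 2 * ‖z‖ ^ 2 = ‖(s : ℂ) * β - α‖ ^ 2 := by
    rw [← h1, norm_mul, mul_pow, Complex.norm_real, Real.norm_eq_abs, sq_abs]
  have hK : 0 < ‖β - α‖ ^ 2 := by
    have : 0 < ‖β - α‖ := norm_pos_iff.2 (sub_ne_zero.2 h.symm)
    positivity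
  have h3 : ‖(s : ℂ) * β - α‖ ^ 2 = (s - 1) ^ 2 + s * ‖β - α‖ ^ 2 := by
    have ha : Complex.normSq α = 1 := by rw [Complex.normSq_eq_norm_sq, hα]; norm_num
    have hb : Complex.normSq β = 1 := by rw [Complex.normSq_eq_norm_sq, hβ]; norm_num
    rw [← Complex.normSq_eq_norm_sq, ← Complex.normSq_eq_norm_sq]
    simp only [Complex.normSq_apply, Complex.sub_re, Complex.sub_im, Complex.re_ofReal_mul,
      Complex.im_ofReal_mul] at ha hb ⊢
    linear_combination (1 - s) * ha + (s ^ 2 - s) * hb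
  have h4 : ‖z‖ ^ 2 ≤ 1 := pow_le_one₀ (norm_nonneg z) hz
  nlinarith [mul_pos hs hK, sq_nonneg (s - 1)]

theorem differentiableOn_hypMap {α β : ℂ} (hα : ‖α‖ = 1) (hβ : ‖β‖ = 1) (h : α ≠ β) {s : ℝ}
    (hs : 0 < s) : DifferentiableOn ℂ (hypMap α β s) (Metric.closedBall 0 1) := by
  unfold hypMap
  refine DifferentiableOn.div (by fun_prop) (by fun_prop) fun z hz => ?_
  exact hypMap_denom_ne_zero hα hβ h hs (by simpa using hz)

namespace IsHyperbolicAut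

variable {φ : Equiv.Perm 𝔻} {α β : ℂ} {μ : ℝ}

theorem multiplier_pos (hφ : IsHyperbolicAut φ α β μ) : 0 < μ :=
  zero_lt_one.trans hφ.one_lt_multiplier

theorem conj_dilation_zpow (hφ : IsHyperbolicAut φ α β μ) (n : ℤ) (z : 𝔻) :
    (((φ ^ n) z : ℂ) - β) / (((φ ^ n) z : ℂ) - α) =
      ((μ ^ n : ℝ) : ℂ) * (((z : ℂ) - β) / ((z : ℂ) - α)) := by
  have hμ : (μ : ℂ) ≠ 0 := by exact_mod_cast hφ.multiplier_pos.ne'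
  induction n with
  | zero => simp
  | succ n ih =>
    rw [add_comm, zpow_one_add, Equiv.Perm.mul_apply, hφ.conj_dilation, ih]
    push_cast
    rw [zpow_one_add₀ hμ]
    ring
  | pred n ih =>
    have hstep : (φ ^ (-(n : ℤ))) z = φ ((φ ^ (-(n : ℤ) - 1)) z) := by
      rw [← Equiv.Perm.mul_apply, ← zpow_one_add]
      congr 2
      ring
    rw [hstep, hφ.conj_dilation] at ih
    push_cast at ih ⊢
    rw [zpow_sub_one₀ hμ, mul_right_comm, ← ih]
    field_simp

theorem coe_zpow_eq_hypMap (hφ : IsHyperbolicAut φ α β μ) (n : ℤ) (z : 𝔻) :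
    ((φ ^ n) z : ℂ) = hypMap α β (μ ^ n) z := by
  have h := hφ.conj_dilation_zpow n z
  rw [← mul_div_assoc, div_eq_div_iff (coe_ne_of_norm_eq_one hφ.norm_attractive _)
    (coe_ne_of_norm_eq_one hφ.norm_attractive _)] at h
  rw [hypMap, eq_div_iff (hypMap_denom_ne_zero hφ.norm_attractive hφ.norm_repulsive hφ.fixed_ne
    (zpow_pos hφ.multiplier_pos n) z.norm_lt_one.le)]
  linear_combination -h

theorem mapsTo_hypMap (hφ : IsHyperbolicAut φ α β μ) (n : ℤ) :
    MapsTo (hypMap α β (μ ^ n)) (Metric.closedBall 0 1) (Metric.closedBall 0 1) := by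
  have h : MapsTo (hypMap α β (μ ^ n)) (Metric.ball 0 1) (Metric.ball 0 1) := by
    intro z hz
    have := hφ.coe_zpow_eq_hypMap n (Complex.UnitDisc.mk z (by simpa using hz))
    rw [Complex.UnitDisc.coe_mk] at this
    rw [← this]
    simpa using Complex.UnitDisc.norm_lt_one _
  have hc := (differentiableOn_hypMap hφ.norm_attractive hφ.norm_repulsive hφ.fixed_ne
    (zpow_pos hφ.multiplier_pos n)).continuousOn
  rw [← closure_ball (0 : ℂ) one_ne_zero] at hc ⊢
  exact h.closure_of_continuousOn hc

theorem discHolo_comp_zpow (hφ : IsHyperbolicAut φ α β μ) (n : ℤ) {f : 𝔻 → ℂ} (hf : DiscHolo f) :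
    DiscHolo fun z => f ((φ ^ n) z) :=
  hf.comp ((differentiableOn_hypMap hφ.norm_attractive hφ.norm_repulsive hφ.fixed_ne
    (zpow_pos hφ.multiplier_pos n)).mono Metric.ball_subset_closedBall) (hφ.coe_zpow_eq_hypMap n)

end IsHyperbolicAut

noncomputable section

/-- A sequence of radii increasing to `1`. -/
def radius (k : ℕ) : ℝ := 1 - 1 / ((k : ℝ) + 1)

end

theorem radius_mem (k : ℕ) : radius k ∈ Ico (0 : ℝ) 1 := by
  have h : (0 : ℝ) < 1 / ((k : ℝ) + 1) := by positivity
  have h' : 1 / ((k : ℝ) + 1) ≤ 1 := by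
    rw [div_le_one (by positivity)]
    linarith [k.cast_nonneg (α := ℝ)]
  exact ⟨by unfold radius; linarith, by unfold radius; linarith⟩

theorem tendsto_radius : Tendsto radius atTop (𝓝 1) := by
  have h := (tendsto_one_div_add_atTop_nhds_zero_nat (𝕜 := ℝ)).const_sub 1
  rw [sub_zero] at h
  exact h

theorem norm_radius_mul_lt (k : ℕ) {z : ℂ} (hz : ‖z‖ ≤ 1) : ‖(radius k : ℂ) * z‖ < 1 := by
  have := radius_mem k
  rw [norm_mul, Complex.norm_real, Real.norm_of_nonneg this.1]
  nlinarith [norm_nonneg z, this.1, this.2]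

theorem DiscHolo.dilate {g : 𝔻 → ℂ} (hg : DiscHolo g) (k : ℕ) :
    DiscHolo fun z : 𝔻 => discExt g (radius k * z) := by
  refine DiscHolo.of_eq (F := fun z => discExt g (radius k * z)) ?_ fun _ => rfl
  refine DifferentiableOn.comp (t := Metric.ball 0 1) hg (by fun_prop) fun z hz => ?_
  simpa using norm_radius_mul_lt k (z := z) (by simpa using (mem_ball_zero_iff.1 hz).le)

theorem IsHyperbolicAut.hardyENorm_comp_dilate_le {φ : Equiv.Perm 𝔻} {α β : ℂ} {μ : ℝ}
    (hφ : IsHyperbolicAut φ α β μ) {Q g : 𝔻 → ℂ} (hQ : DiscHolo Q) (hg : DiscHolo g)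
    {ω : ℂ → ℝ} (hω : Continuous ω) (hω0 : ∀ z, 0 ≤ ω z) (hQω : ∀ z : 𝔻, ‖Q z‖ ^ 2 = ω z)
    (n : ℤ) (k : ℕ) :
    hardyENorm 2 (fun z => Q ((φ ^ n) z) * discExt g (radius k * ((φ ^ n) z : ℂ))) ^ 2 ≤
      ∫⁻ ζ : ℂ, ENNReal.ofReal (ω ζ * hypJac α β (μ ^ n) ζ) * ‖discExt g (radius k * ζ)‖ₑ ^ 2
        ∂arcMeasure := by
  have hs := zpow_pos hφ.multiplier_pos n
  set M := hypMap α β (μ ^ n) with hM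
  have hMc : ContinuousOn M (Metric.closedBall 0 1) :=
    (differentiableOn_hypMap hφ.norm_attractive hφ.norm_repulsive hφ.fixed_ne hs).continuousOn
  have hgc : ContinuousOn (fun z => discExt g (radius k * z)) (Metric.closedBall 0 1) := by
    refine ContinuousOn.comp (t := Metric.ball 0 1) hg.continuousOn (by fun_prop) fun z hz => ?_
    simpa using norm_radius_mul_lt k (z := z) (by simpa using hz)
  have hu : ContinuousOn (fun z => ω (M z) * ‖discExt g (radius k * M z)‖ ^ 2)
      (Metric.closedBall 0 1) :=
    (hω.comp_continuousOn hMc).mul (((hgc.comp hMc (hφ.mapsTo_hypMap n)).norm).pow 2)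
  have h1 := hardyENorm_sq_le_lintegral
    (hφ.discHolo_comp_zpow n (hQ.mul (hg.dilate k))) hu fun z => by
      rw [norm_mul, mul_pow, hQω, hφ.coe_zpow_eq_hypMap]
  refine h1.trans (le_of_eq ?_)
  have hF : Measurable fun ζ : ℂ => ENNReal.ofReal (ω ζ * ‖discExt g (radius k * ζ)‖ ^ 2) :=
    (hω.measurable.mul ((hg.stronglyMeasurable _).measurable.norm.pow_const 2)).ennreal_ofReal
  have h2 := lintegral_comp_hypMap hφ.norm_attractive hφ.norm_repulsive hφ.fixed_ne hs hF
  rw [h2]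
  refine lintegral_congr fun ζ => ?_
  have hJ : 0 ≤ hypJac α β (μ ^ n) ζ := by
    unfold hypJac
    positivity
  rw [← ofReal_norm, ← ENNReal.ofReal_pow (norm_nonneg _), ← ENNReal.ofReal_mul hJ,
    ← ENNReal.ofReal_mul (mul_nonneg (hω0 _) hJ)]
  congr 1
  ring

/-- If `f = Q g` where `|Q|² = ω` is continuous on the closed disc, then the Hardy norm of
`f ∘ φ_n` is controlled by weighted means of `|g|²` over circles, where the weight is the product
of `ω` and a Jacobian. -/
theorem IsHyperbolicAut.hardyENorm_comp_zpow_le {φ : Equiv.Perm 𝔻} {α β : ℂ} {μ : ℝ}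
    (hφ : IsHyperbolicAut φ α β μ) {f Q g : 𝔻 → ℂ} (hQ : DiscHolo Q) (hg : DiscHolo g)
    (hf : ∀ z, f z = Q z * g z)
    {ω : ℂ → ℝ} (hω : Continuous ω) (hω0 : ∀ z, 0 ≤ ω z) (hQω : ∀ z : 𝔻, ‖Q z‖ ^ 2 = ω z)
    (n : ℤ) :
    hardyENorm 2 (fun z => f ((φ ^ n) z)) ^ 2 ≤
      liminf (fun k => ∫⁻ ζ : ℂ, ENNReal.ofReal (ω ζ * hypJac α β (μ ^ n) ζ) *
        ‖discExt g (radius k * ζ)‖ₑ ^ 2 ∂arcMeasure) atTop := by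
  rw [hardyENorm_two_sq]
  refine iSup₂_le fun r hr => ?_
  set h : ℕ → 𝔻 → ℂ := fun k z => Q ((φ ^ n) z) * discExt g (radius k * ((φ ^ n) z : ℂ)) with hh
  have hhol : ∀ k, DiscHolo (h k) := fun k => hφ.discHolo_comp_zpow n (hQ.mul (hg.dilate k))
  have hae : ∀ᵐ ζ : ℂ ∂arcMeasure, ‖discExt (fun z => f ((φ ^ n) z)) (r * ζ)‖ₑ ^ 2 =
      liminf (fun k => ‖discExt (h k) (r * ζ)‖ₑ ^ 2) atTop := by
    filter_upwards [ae_norm_eq_one] with ζ hζ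
    have hz : ‖(r : ℂ) * ζ‖ < 1 := by simpa [hζ, abs_of_nonneg hr.1] using hr.2
    rw [discExt_of_norm_lt _ _ hz]
    simp only [discExt_of_norm_lt _ _ hz]
    set y := (φ ^ n) (Complex.UnitDisc.mk _ hz)
    symm
    refine Tendsto.liminf_eq ?_
    have h1 : Tendsto (fun k => (radius k : ℂ) * (y : ℂ)) atTop (𝓝 (y : ℂ)) := by
      have : Continuous fun x : ℝ => (x : ℂ) * (y : ℂ) := by fun_prop
      simpa [Function.comp_def] using (this.tendsto 1).comp tendsto_radius
    have hgc : ContinuousAt (discExt g) y :=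
      (hg.differentiableAt (Metric.isOpen_ball.mem_nhds
        (by simpa using y.norm_lt_one))).continuousAt
    have h2 := (hgc.tendsto.comp h1).const_mul (Q y)
    rw [discExt_coe] at h2
    rw [hf]
    exact ((ENNReal.continuous_pow 2).tendsto _).comp ((continuous_enorm.tendsto _).comp h2)
  rw [lintegral_congr_ae hae]
  refine (lintegral_liminf_le fun k =>
    ((hhol k).stronglyMeasurable r).measurable.enorm.pow_const 2).trans ?_
  refine liminf_le_liminf (Eventually.of_forall fun k => ?_)
  exact (lintegral_le_hardyENorm_sq (h k) hr).trans
    (hφ.hardyENorm_comp_dilate_le hQ hg hω hω0 hQω n k)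

/-! ### Estimates for the Jacobian -/

/-- The two fixed points are seen from the points of the circle under an angle bounded away from
`0` and `π`. -/
theorem exists_norm_sub_sq_ge {α β : ℂ} (hα : ‖α‖ = 1) (hβ : ‖β‖ = 1) (h : α ≠ β) :
    ∃ κ > 0, ∀ ζ : ℂ, ‖ζ‖ = 1 → ∀ s : ℝ, 0 < s →
      κ * (‖ζ - β‖ + s * ‖ζ - α‖) ^ 2 ≤ ‖(ζ - β) - s * (ζ - α)‖ ^ 2 := by
  have conj_mul : ∀ z : ℂ, ‖z‖ = 1 → z * (starRingEnd ℂ) z = 1 := fun z hz => by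
    rw [Complex.mul_conj, Complex.normSq_eq_norm_sq, hz]
    simp
  set u : ℂ := β * (starRingEnd ℂ) α with hu
  have hun : ‖u‖ = 1 := by simp [hu, hα, hβ]
  have hu1 : u.re < 1 := by
    refine lt_of_le_of_ne ((Complex.re_le_norm u).trans hun.le) fun hre => h ?_
    have him : u.im = 0 := by
      have := Complex.normSq_eq_norm_sq u
      rw [hun, Complex.normSq_apply, hre] at this
      nlinarith
    have hu' : u = 1 := Complex.ext (by simpa using hre) (by simpa using him)
    have := conj_mul α hα
    calc α = α * u := by rw [hu', mul_one]
      _ = β * (α * (starRingEnd ℂ) α) := by rw [hu]; ring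
      _ = β := by rw [this, mul_one]
  set c : ℝ := √((1 + u.re) / 2) with hc
  have hre' : -1 ≤ u.re := by
    have := (abs_le.1 (Complex.abs_re_le_norm u)).1
    rwa [hun] at this
  have hc2 : c ^ 2 = (1 + u.re) / 2 := Real.sq_sqrt (by linarith)
  have hc0 : 0 ≤ c := Real.sqrt_nonneg _
  have hc1 : c < 1 := by nlinarith
  refine ⟨(1 - c) / 2, by linarith, fun ζ hζ s hs => ?_⟩
  set X : ℂ := (ζ - β) * (starRingEnd ℂ) (ζ - α) with hX
  have hXu : X = (starRingEnd ℂ) X * u := by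
    have h1 := conj_mul ζ hζ
    have h2 := conj_mul α hα
    have h3 := conj_mul β hβ
    simp only [hX, hu, map_mul, map_sub, Complex.conj_conj]
    linear_combination (1 - β * (starRingEnd ℂ) α) * h1 +
      ((starRingEnd ℂ) α * ζ - 1) * h3 + (β * (starRingEnd ℂ) ζ - β * (starRingEnd ℂ) β) * h2
  have hXX : X * X = ((Complex.normSq X : ℝ) : ℂ) * u := by
    nth_rewrite 1 [hXu]
    rw [← Complex.mul_conj]
    ring
  have hXre : X.re ^ 2 = c ^ 2 * Complex.normSq X := by
    have h1 := congrArg Complex.re hXX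
    rw [Complex.mul_re, Complex.re_ofReal_mul] at h1
    have h2 := Complex.normSq_apply X
    rw [hc2]
    linear_combination h1 / 2 - h2 / 2
  have hXabs : X.re ≤ c * (‖ζ - β‖ * ‖ζ - α‖) := by
    refine le_of_sq_le_sq ?_ (by positivity)
    rw [hXre, mul_pow, Complex.normSq_eq_norm_sq, hX, norm_mul, Complex.norm_conj]
  have hexp : ‖(ζ - β) - s * (ζ - α)‖ ^ 2 =
      ‖ζ - β‖ ^ 2 + s ^ 2 * ‖ζ - α‖ ^ 2 - 2 * s * X.re := by
    rw [← Complex.normSq_eq_norm_sq, ← Complex.normSq_eq_norm_sq, ← Complex.normSq_eq_norm_sq,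
      Complex.normSq_sub]
    have h1 : (ζ - β) * (starRingEnd ℂ) (s * (ζ - α)) = s * X := by
      rw [map_mul, Complex.conj_ofReal, hX]
      ring
    rw [h1, Complex.re_ofReal_mul, map_mul, Complex.normSq_ofReal]
    ring
  rw [hexp]
  have hA := norm_nonneg (ζ - α)
  have hB := norm_nonneg (ζ - β)
  nlinarith [mul_nonneg hs.le (sub_nonneg.2 hXabs), mul_nonneg (sub_nonneg.2 hc1.le)
    (sq_nonneg (‖ζ - β‖ - s * ‖ζ - α‖)), mul_nonneg hc0 (sq_nonneg (‖ζ - β‖ - s * ‖ζ - α‖))]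

theorem exists_mul_hypJac_le {α β : ℂ} (hα : ‖α‖ = 1) (hβ : ‖β‖ = 1) (h : α ≠ β) :
    ∃ C > 0, ∀ ζ : ℂ, ‖ζ‖ = 1 → ∀ s : ℝ, 0 < s →
      ‖ζ - α‖ * ‖ζ - β‖ * hypJac α β s ζ ≤
        C * (s * ‖ζ - α‖ * ‖ζ - β‖ / (‖ζ - β‖ + s * ‖ζ - α‖) ^ 2) := by
  obtain ⟨κ, hκ, hle⟩ := exists_norm_sub_sq_ge hα hβ h
  have hK : 0 < ‖α - β‖ := norm_pos_iff.2 (sub_ne_zero.2 h)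
  refine ⟨‖α - β‖ ^ 2 / κ, by positivity, fun ζ hζ s hs => ?_⟩
  rcases eq_or_lt_of_le (norm_nonneg (ζ - β)) with hB | hB
  · rw [← hB]
    simp
  have hpos : 0 < ‖ζ - β‖ + s * ‖ζ - α‖ := by positivity
  calc ‖ζ - α‖ * ‖ζ - β‖ * hypJac α β s ζ
      ≤ ‖ζ - α‖ * ‖ζ - β‖ * (s * ‖α - β‖ ^ 2 / (κ * (‖ζ - β‖ + s * ‖ζ - α‖) ^ 2)) := by
        unfold hypJac
        gcongr
        exact hle ζ hζ s hs
    _ = _ := by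
        field_simp

theorem mul_div_add_sq_le_rpow {x y τ : ℝ} (hx : 0 < x) (hy : 0 < y) (h0 : 0 ≤ τ) (h1 : τ ≤ 1) :
    x * y / (y + x) ^ 2 ≤ (y / x) ^ τ := by
  have hxy : 0 < y / x := by positivity
  rcases le_total y x with hle | hle
  · have h2 : y / x ≤ 1 := (div_le_one hx).2 hle
    calc x * y / (y + x) ^ 2 ≤ y / x := by
          rw [div_le_div_iff₀ (by positivity) hx]
          nlinarith [mul_pos hx hy, mul_pos (mul_pos hx hy) hy, mul_pos hy (mul_pos hy hy)]
      _ = (y / x) ^ (1 : ℝ) := (Real.rpow_one _).symm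
      _ ≤ (y / x) ^ τ := Real.rpow_le_rpow_of_exponent_ge hxy h2 h1
  · have h2 : 1 ≤ y / x := (one_le_div hx).2 hle
    refine le_trans ?_ (Real.one_le_rpow h2 h0)
    rw [div_le_one (by positivity)]
    nlinarith [mul_pos hx hy, sq_nonneg x, sq_nonneg y]

theorem exists_mul_hypJac_le_rpow {α β : ℂ} (hα : ‖α‖ = 1) (hβ : ‖β‖ = 1) (h : α ≠ β) :
    ∃ C > 0, ∀ ζ : ℂ, ‖ζ‖ = 1 → ∀ s : ℝ, 0 < s → ∀ τ : ℝ, 0 ≤ τ → τ ≤ 1 →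
      ‖ζ - α‖ * ‖ζ - β‖ * hypJac α β s ζ * ‖ζ - α‖ ^ τ ≤ C * (s ^ (-τ) * ‖ζ - β‖ ^ τ) ∧
      ‖ζ - α‖ * ‖ζ - β‖ * hypJac α β s ζ * ‖ζ - β‖ ^ τ ≤ C * (s ^ τ * ‖ζ - α‖ ^ τ) := by
  obtain ⟨C, hC, hle⟩ := exists_mul_hypJac_le hα hβ h
  refine ⟨C, hC, fun ζ hζ s hs τ h0 h1 => ?_⟩
  have hl := hle ζ hζ s hs
  rcases eq_or_lt_of_le (norm_nonneg (ζ - α)) with hA | hA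
  · rw [← hA] at hl ⊢
    simp only [zero_mul]
    constructor <;> positivity
  rcases eq_or_lt_of_le (norm_nonneg (ζ - β)) with hB | hB
  · rw [← hB] at hl ⊢
    simp only [mul_zero, zero_mul]
    constructor <;> positivity
  set A := ‖ζ - α‖
  set B := ‖ζ - β‖
  have hsA : 0 < s * A := by positivity
  constructor
  · have h2 := mul_div_add_sq_le_rpow hsA hB h0 h1
    calc A * B * hypJac α β s ζ * A ^ τ ≤ C * (B / (s * A)) ^ τ * A ^ τ := by
          exact mul_le_mul_of_nonneg_right (hl.trans (by gcongr)) (by positivity)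
      _ = C * (s ^ (-τ) * B ^ τ) := by
          rw [Real.div_rpow hB.le hsA.le, Real.mul_rpow hs.le hA.le, Real.rpow_neg hs.le]
          have := Real.rpow_pos_of_pos hA τ
          have := Real.rpow_pos_of_pos hs τ
          field_simp
  · have h2 := mul_div_add_sq_le_rpow hB hsA h0 h1
    rw [mul_comm B, add_comm] at h2
    calc A * B * hypJac α β s ζ * B ^ τ ≤ C * (s * A / B) ^ τ * B ^ τ := by
          exact mul_le_mul_of_nonneg_right (hl.trans (by gcongr)) (by positivity)
      _ = C * (s ^ τ * A ^ τ) := by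
          rw [Real.div_rpow hsA.le hB.le, Real.mul_rpow hs.le hA.le]
          have := Real.rpow_pos_of_pos hB τ
          field_simp

theorem summable_zpow_neg_natAbs {μ : ℝ} (hμ : 1 < μ) :
    Summable fun n : ℤ => (μ⁻¹) ^ n.natAbs := by
  have h := summable_geometric_of_lt_one (by positivity) (inv_lt_one_of_one_lt₀ hμ)
  exact Summable.of_nat_of_neg (by simpa using h) (by simpa using h)

theorem mul_div_add_sq_le_natAbs {μ v : ℝ} (hμ : 1 < μ) (h1 : 1 ≤ v) (h2 : v < μ) (n : ℤ) :
    v * μ ^ n / (1 + v * μ ^ n) ^ 2 ≤ μ * (μ⁻¹) ^ n.natAbs := by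
  have hμ0 : 0 < μ := by linarith
  have hv : 0 < v := by linarith
  have hx : 0 < μ ^ n := zpow_pos hμ0 n
  obtain ⟨m, rfl | rfl⟩ := n.eq_nat_or_neg
  · simp only [Int.natAbs_natCast, zpow_natCast] at hx ⊢
    rw [div_le_iff₀ (by positivity), inv_pow]
    have : μ * (μ ^ m)⁻¹ * (1 + v * μ ^ m) ^ 2 =
        μ * (μ ^ m)⁻¹ + 2 * μ * v + μ * v * (v * μ ^ m) := by
      field_simp
      ring
    rw [this]
    have h3 : 1 ≤ μ * v := by nlinarith
    have h4 : 0 < v * μ ^ m := by positivity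
    have h5 : 0 < μ * (μ ^ m)⁻¹ := by positivity
    nlinarith [mul_nonneg (sub_nonneg.2 h3) h4.le]
  · simp only [Int.natAbs_neg, Int.natAbs_natCast, zpow_neg, zpow_natCast, inv_pow] at hx ⊢
    rw [div_le_iff₀ (by positivity)]
    have h4 : 0 < v * (μ ^ m)⁻¹ := by positivity
    have h5 : 1 ≤ (1 + v * (μ ^ m)⁻¹) ^ 2 := by nlinarith
    calc v * (μ ^ m)⁻¹ ≤ μ * (μ ^ m)⁻¹ := by gcongr
      _ ≤ _ := le_mul_of_one_le_right (by positivity) h5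

theorem exists_tsum_mul_hypJac_le {α β : ℂ} (hα : ‖α‖ = 1) (hβ : ‖β‖ = 1) (h : α ≠ β) {μ : ℝ}
    (hμ : 1 < μ) : ∃ C : ℝ, ∀ ζ : ℂ, ‖ζ‖ = 1 →
      ∑' n : ℤ, ENNReal.ofReal (‖ζ - α‖ * ‖ζ - β‖ * hypJac α β (μ ^ n) ζ) ≤ ENNReal.ofReal C := by
  obtain ⟨C, hC, hle⟩ := exists_mul_hypJac_le hα hβ h
  have hμ0 : 0 < μ := by linarith
  have hsum := summable_zpow_neg_natAbs hμ
  refine ⟨C * (μ * ∑' n : ℤ, (μ⁻¹) ^ n.natAbs), fun ζ hζ => ?_⟩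
  rcases eq_or_lt_of_le (norm_nonneg (ζ - α)) with hA | hA
  · simp [← hA]
  rcases eq_or_lt_of_le (norm_nonneg (ζ - β)) with hB | hB
  · simp [← hB]
  have hl := hle ζ hζ
  set A := ‖ζ - α‖
  set B := ‖ζ - β‖
  obtain ⟨m, hm1, hm2⟩ := exists_mem_Ico_zpow (x := A / B) (y := μ) (by positivity) hμ
  set v := A / B * μ ^ (-m) with hv
  have hv1 : 1 ≤ v := by
    rw [hv, zpow_neg, ← div_eq_mul_inv, one_le_div (zpow_pos hμ0 m)]
    exact hm1
  have hv2 : v < μ := by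
    rw [hv, zpow_neg, ← div_eq_mul_inv, div_lt_iff₀ (zpow_pos hμ0 m), ← zpow_one_add₀ hμ0.ne',
      add_comm]
    exact hm2
  calc ∑' n : ℤ, ENNReal.ofReal (A * B * hypJac α β (μ ^ n) ζ)
      = ∑' n : ℤ, ENNReal.ofReal (A * B * hypJac α β (μ ^ (n - m)) ζ) :=
        ((Equiv.subRight m).tsum_eq fun n : ℤ =>
          ENNReal.ofReal (A * B * hypJac α β (μ ^ n) ζ)).symm
    _ ≤ ∑' n : ℤ, ENNReal.ofReal (C * (μ * (μ⁻¹) ^ n.natAbs)) := by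
        refine ENNReal.tsum_le_tsum fun n => ENNReal.ofReal_le_ofReal ?_
        refine (hl _ (zpow_pos hμ0 _)).trans ?_
        gcongr
        refine le_trans (le_of_eq ?_) (mul_div_add_sq_le_natAbs hμ hv1 hv2 n)
        have hx := zpow_pos hμ0 n
        have hy := zpow_pos hμ0 m
        have : B + μ ^ n / μ ^ m * A ≠ 0 := by positivity
        rw [hv, zpow_sub₀ hμ0.ne', zpow_neg]
        field_simp
    _ = _ := by
        rw [← ENNReal.ofReal_tsum_of_nonneg (fun n => by positivity)
          ((hsum.mul_left μ).mul_left C), tsum_mul_left, tsum_mul_left]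

/-! ### Fourier series with coefficients in a Hilbert space -/

theorem sum_Icc_neg_eq_sum_range {M : Type*} [AddCommMonoid M] (g : ℤ → M) (N : ℕ) :
    ∑ n ∈ Finset.Icc (-(N : ℤ)) N, g n = ∑ j ∈ Finset.range (2 * N + 1), g (j - N) := by
  refine Finset.sum_bij' (fun n _ => (n + N).toNat) (fun j _ => (j : ℤ) - N) ?_ ?_ ?_ ?_ ?_
  · intro n hn
    simp only [Finset.mem_Icc, Finset.mem_range] at *
    omega
  · intro j hj
    simp only [Finset.mem_Icc, Finset.mem_range] at *
    omega
  · intro n hn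
    simp only [Finset.mem_Icc] at *
    omega
  · intro j hj
    simp
  · intro n hn
    simp only [Finset.mem_Icc] at hn
    congr 1
    omega

theorem sum_Icc_neg_shift {M : Type*} [AddCommGroup M] (g : ℤ → M) (N : ℕ) :
    ∑ n ∈ Finset.Icc (-(N : ℤ)) N, g (n - 1) =
      ∑ n ∈ Finset.Icc (-(N : ℤ)) N, g n + (g (-N - 1) - g N) := by
  rw [sum_Icc_neg_eq_sum_range g, sum_Icc_neg_eq_sum_range fun n => g (n - 1)]
  have h := Finset.sum_range_sub (fun j : ℕ => g ((j : ℤ) - N - 1)) (2 * N + 1)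
  rw [Finset.sum_sub_distrib] at h
  have h1 : ∀ j : ℕ, ((j + 1 : ℕ) : ℤ) - N - 1 = j - N := fun j => by push_cast; ring
  simp only [h1] at h
  rw [← sub_eq_iff_eq_add', ← neg_sub, h]
  push_cast
  rw [show (2 * (N : ℤ) - N) = N by ring, show (0 - (N : ℤ) - 1) = -N - 1 by ring]
  abel

section Hilbert

variable {E : Type*} [NormedAddCommGroup E] [InnerProductSpace ℂ E]

theorem stronglyMeasurable_sum_zpow_smul (S : Finset ℤ) (k : ℤ → E) :
    StronglyMeasurable fun ζ : ℂ => ∑ n ∈ S, ζ ^ n • k n := by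
  refine Finset.stronglyMeasurable_fun_sum S fun n _ => ?_
  have hm : Measurable fun ζ : ℂ => ζ ^ n := by fun_prop
  exact hm.stronglyMeasurable.smul_const (k n)

theorem eLpNorm_sum_zpow_smul_sq (S : Finset ℤ) (k : ℤ → E) :
    eLpNorm (fun ζ : ℂ => ∑ n ∈ S, ζ ^ n • k n) 2 arcMeasure ^ 2 =
      ENNReal.ofReal (∑ n ∈ S, ‖k n‖ ^ 2) := by
  rw [eLpNorm_two_sq, ← integral_norm_sq_sum_zpow_smul, ofReal_integral_eq_lintegral_ofReal]
  · refine lintegral_congr fun ζ => ?_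
    rw [← ofReal_norm, ENNReal.ofReal_pow (norm_nonneg _)]
  · refine Integrable.of_bound
      ((stronglyMeasurable_sum_zpow_smul S k).norm.measurable.pow_const 2).aestronglyMeasurable
      ((∑ n ∈ S, ‖k n‖) ^ 2) ?_
    filter_upwards [ae_norm_eq_one] with ζ hζ
    rw [Real.norm_of_nonneg (by positivity)]
    gcongr
    refine (norm_sum_le _ _).trans (le_of_eq ?_)
    simp [norm_smul, hζ]
  · exact Eventually.of_forall fun _ => by positivity

theorem eLpNorm_sum_sub_sum_sq {A B : Finset ℤ} (h : B ⊆ A) (k : ℤ → E) :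
    eLpNorm ((fun ζ : ℂ => ∑ n ∈ A, ζ ^ n • k n) - fun ζ : ℂ => ∑ n ∈ B, ζ ^ n • k n) 2
      arcMeasure ^ 2 = ENNReal.ofReal (∑ n ∈ A \ B, ‖k n‖ ^ 2) := by
  rw [← eLpNorm_sum_zpow_smul_sq]
  congr 2
  funext ζ
  rw [Pi.sub_apply, ← Finset.sum_sdiff h, add_sub_cancel_right]

/-- A Fourier series with square-summable coefficients in a Hilbert space converges, along a
subsequence, almost everywhere on the unit circle; if a coefficient does not vanish, the sum is
nonzero on a set of positive measure. -/
theorem exists_measurableSet_tendsto_sum_zpow_smul [CompleteSpace E] {k : ℤ → E}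
    (hk : Summable fun n => ‖k n‖ ^ 2) (h0 : k 0 ≠ 0) :
    ∃ (N : ℕ → ℕ) (T : Set ℂ), Tendsto N atTop atTop ∧ MeasurableSet T ∧
      T ⊆ Metric.sphere 0 1 ∧ 0 < arcMeasure T ∧ ∀ c ∈ T, ∃ l ≠ (0 : E),
        Tendsto (fun j => ∑ n ∈ Finset.Icc (-(N j : ℤ)) (N j), c ^ n • k n) atTop (𝓝 l) := by
  have htail : ∀ j : ℕ, ∃ M : ℕ, ∀ t : Finset ℤ, Disjoint t (Finset.Icc (-(M : ℤ)) M) →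
      ∑ n ∈ t, ‖k n‖ ^ 2 < (1 / 4) ^ j := by
    intro j
    obtain ⟨s, hs⟩ := summable_iff_vanishing_norm.1 hk ((1 / 4) ^ j) (by positivity)
    refine ⟨∑ n ∈ s, n.natAbs, fun t ht => lt_of_abs_lt (hs t (ht.mono_right fun n hn => ?_))⟩
    have := Finset.single_le_sum (f := Int.natAbs) (fun _ _ => Nat.zero_le _) hn
    simp only [Finset.mem_Icc]
    omega
  choose M hM using htail
  set N : ℕ → ℕ := fun j => ∑ i ∈ Finset.range (j + 1), M i + j with hN
  have hNmono : Monotone N := by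
    intro a b hab
    simp only [hN]
    gcongr
  have hNM : ∀ i j, i ≤ j → M i ≤ N j := fun i j hij =>
    (Finset.single_le_sum (f := M) (fun _ _ => Nat.zero_le _)
      (Finset.mem_range.2 (by omega))).trans (Nat.le_add_right _ _)
  have hNtop : Tendsto N atTop atTop :=
    tendsto_atTop_mono (fun j => Nat.le_add_left j _) tendsto_id
  set S : ℕ → ℂ → E := fun j ζ => ∑ n ∈ Finset.Icc (-(N j : ℤ)) (N j), ζ ^ n • k n with hS
  have hSm : ∀ j, StronglyMeasurable (S j) := fun j => stronglyMeasurable_sum_zpow_smul _ k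
  have hcau' : ∀ i n m : ℕ, i ≤ m → m ≤ n →
      eLpNorm (S n - S m) 2 arcMeasure < ENNReal.ofReal ((1 / 2) ^ i) := by
    intro i n m him hmn
    have hsub : Finset.Icc (-(N m : ℤ)) (N m) ⊆ Finset.Icc (-(N n : ℤ)) (N n) := by
      have := hNmono hmn
      apply Finset.Icc_subset_Icc <;> omega
    have h1 := eLpNorm_sum_sub_sum_sq hsub k
    have h2 : ENNReal.ofReal (∑ n ∈ Finset.Icc (-(N n : ℤ)) (N n) \ Finset.Icc (-(N m : ℤ)) (N m),
        ‖k n‖ ^ 2) < ENNReal.ofReal ((1 / 2) ^ i) ^ 2 := by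
      rw [← ENNReal.ofReal_pow (by positivity), ← pow_mul, mul_comm, pow_mul]
      refine (ENNReal.ofReal_lt_ofReal_iff (by positivity)).2 ?_
      refine lt_of_lt_of_eq (hM i _ ?_) (by norm_num)
      have := hNM i m him
      refine Finset.sdiff_disjoint.mono_right ?_
      apply Finset.Icc_subset_Icc <;> omega
    rw [← h1] at h2
    exact lt_of_not_ge fun hle => h2.not_ge (pow_le_pow_left' hle 2)
  have hcau : ∀ i n m : ℕ, i ≤ n → i ≤ m →
      eLpNorm (S n - S m) 2 arcMeasure < ENNReal.ofReal ((1 / 2) ^ i) := by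
    intro i n m hin him
    rcases le_total m n with h | h
    · exact hcau' i n m him h
    · rw [eLpNorm_sub_comm]
      exact hcau' i m n hin h
  have hB : ∑' i : ℕ, ENNReal.ofReal ((1 / 2) ^ i) ≠ ∞ := by
    rw [← ENNReal.ofReal_tsum_of_nonneg (fun _ => by positivity) summable_geometric_two]
    exact ENNReal.ofReal_ne_top
  have hae := Lp.ae_tendsto_of_cauchy_eLpNorm (fun j => (hSm j).aestronglyMeasurable)
    one_le_two hB hcau
  set Z : Set ℂ := toMeasurable arcMeasure {ζ | ¬∃ l : E, Tendsto (fun j => S j ζ) atTop (𝓝 l)}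
    with hZ
  have hZ0 : arcMeasure Z = 0 := by
    rw [hZ, measure_toMeasurable]
    exact hae
  set W : Set ℂ := {ζ | Tendsto (fun j => ‖S j ζ‖) atTop (𝓝 0)} with hW
  have hWm : MeasurableSet W :=
    measurableSet_tendsto (𝓝 0) fun j => (hSm j).norm.measurable
  refine ⟨N, Metric.sphere 0 1 ∩ Zᶜ ∩ Wᶜ, hNtop,
    (Metric.isClosed_sphere.measurableSet.inter (measurableSet_toMeasurable _ _).compl).inter
      hWm.compl, fun ζ hζ => hζ.1.1, ?_, ?_⟩
  · rw [pos_iff_ne_zero]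
    intro hT
    have hlim : ∀ᵐ ζ ∂arcMeasure, Tendsto (fun j => S j ζ) atTop (𝓝 0) := by
      filter_upwards [ae_norm_eq_one, measure_eq_zero_iff_ae_notMem.1 hZ0,
        measure_eq_zero_iff_ae_notMem.1 hT] with ζ h1 h2 h3
      have : ζ ∈ W := by
        by_contra h4
        exact h3 ⟨⟨by simpa using h1, h2⟩, h4⟩
      exact tendsto_zero_iff_norm_tendsto_zero.2 this
    have h1 := Lp.cauchy_tendsto_of_tendsto (fun j => (hSm j).aestronglyMeasurable) (fun _ => 0)
      hB hcau hlim
    have h2 : ∀ j, ‖k 0‖ₑ ≤ eLpNorm (S j - fun _ => 0) 2 arcMeasure := by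
      intro j
      have h3 : S j - (fun _ => 0) = S j := by
        funext ζ
        simp
      have h4 : ∫ ζ, S j ζ ∂arcMeasure = k 0 :=
        integral_sum_zpow_smul _ k (by simp)
      rw [h3, ← h4]
      refine (enorm_integral_le_lintegral_enorm _).trans ?_
      rw [← eLpNorm_one_eq_lintegral_enorm]
      exact eLpNorm_le_eLpNorm_of_exponent_le one_le_two (hSm j).aestronglyMeasurable
    have h5 := ge_of_tendsto' h1 h2
    simp [h0] at h5
  · rintro c ⟨⟨-, hcZ⟩, hcW⟩
    have h1 : ∃ l : E, Tendsto (fun j => S j c) atTop (𝓝 l) := by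
      by_contra h2
      exact hcZ (subset_toMeasurable _ _ h2)
    obtain ⟨l, hl⟩ := h1
    refine ⟨l, ?_, hl⟩
    rintro rfl
    exact hcW (tendsto_zero_iff_norm_tendsto_zero.1 hl)

end Hilbert

/-! ### Eigenfunctions in doubly cyclic subspaces -/

theorem mem_doublyCyclic {φ : Equiv.Perm 𝔻} {f : HardyTwo} {h : ℤ → HardyTwo}
    (hh : ∀ n z, h n z = f ((φ ^ n) z)) (n : ℤ) :
    h n ∈ Submodule.span ℂ {g : HardyTwo | ∃ n : ℤ, (g : 𝔻 → ℂ) = fun z => f ((φ ^ n) z)} :=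
  Submodule.subset_span ⟨n, funext (hh n)⟩

theorem norm_comp_zpow_le {φ : Equiv.Perm 𝔻} {f : HardyTwo} {h : ℤ → HardyTwo}
    (hh : ∀ n z, h n z = f ((φ ^ n) z)) (n : ℤ) (z : 𝔻) :
    ‖f ((φ ^ n) z)‖ ≤ ‖hardyEval z‖ * ‖h n‖ := by
  have := (hardyEval z).le_opNorm (h n)
  rwa [hardyEval_apply, hh] at this

theorem zpow_apply_apply (φ : Equiv.Perm 𝔻) (n : ℤ) (z : 𝔻) : (φ ^ n) (φ z) = (φ ^ (n + 1)) z := by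
  rw [zpow_add_one, Equiv.Perm.mul_apply]

theorem mem_restrictedPointSpectrum_of_summable {φ : Equiv.Perm 𝔻} {f : HardyTwo}
    {h : ℤ → HardyTwo} (hh : ∀ n z, h n z = f ((φ ^ n) z)) {c : ℂ} (hc : c ≠ 0)
    (hs : Summable fun n : ℤ => c ^ (-n) • h n) (z₀ : 𝔻)
    (hz₀ : ∑' n : ℤ, c ^ (-n) * f ((φ ^ n) z₀) ≠ 0) : c ∈ restrictedPointSpectrum φ f := by
  have happ : ∀ z, HasSum (fun n : ℤ => c ^ (-n) * f ((φ ^ n) z))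
      ((∑' n : ℤ, c ^ (-n) • h n : HardyTwo) z) := by
    intro z
    have := (hardyEval z).hasSum hs.hasSum
    simpa only [hardyEval_apply, HardyTwo.smul_apply, hh] using this
  refine ⟨∑' n : ℤ, c ^ (-n) • h n, ?_, ?_, fun z => ?_⟩
  · refine (Submodule.isClosed_topologicalClosure _).mem_of_tendsto hs.hasSum
      (Eventually.of_forall fun S => Submodule.le_topologicalClosure _ ?_)
    exact Submodule.sum_mem _ fun n _ => Submodule.smul_mem _ _ (mem_doublyCyclic hh n)
  · intro h0
    apply hz₀
    rw [(happ z₀).tsum_eq, h0]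
    rfl
  · rw [← (happ (φ z)).tsum_eq, ← (happ z).tsum_eq, ← tsum_mul_left,
      ← (Equiv.addRight (1 : ℤ)).tsum_eq fun n : ℤ => c * (c ^ (-n) * f ((φ ^ n) z))]
    refine tsum_congr fun n => ?_
    rw [zpow_apply_apply, Equiv.coe_addRight, ← mul_assoc, ← zpow_one_add₀ hc]
    congr 2
    ring

theorem annulus_eq_image_exp {R₁ R₂ : ℝ} (h1 : 0 < R₁) (h2 : 0 < R₂) :
    annulus R₁ R₂ = Complex.exp '' {u | Real.log R₁ < u.re ∧ u.re < Real.log R₂} := by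
  ext c
  constructor
  · rintro ⟨hc1, hc2⟩
    have hc0 : c ≠ 0 := norm_pos_iff.1 (h1.trans hc1)
    refine ⟨Complex.log c, ⟨?_, ?_⟩, Complex.exp_log hc0⟩
    · rw [Complex.log_re]
      exact Real.log_lt_log h1 hc1
    · rw [Complex.log_re]
      exact Real.log_lt_log (h1.trans hc1) hc2
  · rintro ⟨u, ⟨hu1, hu2⟩, rfl⟩
    rw [annulus, mem_ofPred_eq, Complex.norm_exp]
    exact ⟨(Real.log_lt_iff_lt_exp h1).1 hu1, (Real.lt_log_iff_exp_lt h2).1 hu2⟩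

theorem isPreconnected_annulus {R₁ R₂ : ℝ} (h1 : 0 < R₁) (h2 : 0 < R₂) :
    IsPreconnected (annulus R₁ R₂) := by
  rw [annulus_eq_image_exp h1 h2]
  exact ((convex_halfSpace_re_gt _).inter (convex_halfSpace_re_lt _)).isPreconnected.image _
    Complex.continuous_exp.continuousOn

theorem isOpen_annulus (R₁ R₂ : ℝ) : IsOpen (annulus R₁ R₂) :=
  (isOpen_lt continuous_const continuous_norm).inter (isOpen_lt continuous_norm continuous_const)

theorem zpow_le_zpow_add_zpow {r x r' : ℝ} (hr : 0 < r) (h1 : r ≤ x) (h2 : x ≤ r') (n : ℤ) :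
    x ^ n ≤ r ^ n + r' ^ n := by
  have hx := hr.trans_le h1
  have hr' := hx.trans_le h2
  rcases le_total 0 n with hn | hn
  · have := zpow_le_zpow_left₀ hn hx.le h2
    linarith [zpow_pos hr n]
  · have : x ^ n ≤ r ^ n := by
      have hinv : ∀ y : ℝ, y ^ n = y⁻¹ ^ (-n) := fun y => by rw [inv_zpow', neg_neg]
      rw [hinv x, hinv r]
      exact zpow_le_zpow_left₀ (by omega) (by positivity) (inv_anti₀ hr h1)
    linarith [zpow_pos hr' n]

/-- A Laurent series which converges absolutely in an annulus is holomorphic there. -/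
theorem differentiableOn_laurentSeries {a : ℤ → ℂ} {R₁ R₂ : ℝ} (h1 : 0 < R₁)
    (ha : ∀ R, R₁ < R → R < R₂ → Summable fun n : ℤ => ‖a n‖ * R ^ (-n)) :
    DifferentiableOn ℂ (fun c => ∑' n : ℤ, c ^ (-n) * a n) (annulus R₁ R₂) := by
  rintro c ⟨hc1, hc2⟩
  obtain ⟨r, hr1, hrc⟩ := exists_between hc1
  obtain ⟨r', hcr, hr2⟩ := exists_between hc2
  have hr0 := h1.trans hr1
  have hd : DifferentiableOn ℂ (fun c => ∑' n : ℤ, c ^ (-n) * a n) (annulus r r') := by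
    refine Complex.differentiableOn_tsum_of_summable_norm
      ((ha r hr1 (hrc.trans hc2)).add (ha r' (hc1.trans hcr) hr2)) (fun n w hw => ?_)
      (isOpen_annulus r r') fun n w hw => ?_
    · have hw0 : w ≠ 0 := norm_pos_iff.1 (hr0.trans hw.1)
      exact ((differentiableAt_zpow.2 (Or.inl hw0)).mul_const _).differentiableWithinAt
    · rw [norm_mul, norm_zpow, ← mul_add, mul_comm]
      gcongr
      exact zpow_le_zpow_add_zpow hr0 hw.1.le hw.2.le _
  exact (hd.differentiableAt ((isOpen_annulus r r').mem_nhds ⟨hrc, hcr⟩)).differentiableWithinAt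

theorem integral_laurentSeries {a : ℤ → ℂ} (ha : Summable fun n => ‖a n‖) :
    ∫ c : ℂ, ∑' n : ℤ, c ^ (-n) * a n ∂arcMeasure = a 0 := by
  have hint : ∀ n : ℤ, ∫ c : ℂ, ‖c ^ (-n) * a n‖ ∂arcMeasure = ‖a n‖ := by
    intro n
    have : ∀ᵐ c : ℂ ∂arcMeasure, ‖c ^ (-n) * a n‖ = ‖a n‖ := by
      filter_upwards [ae_norm_eq_one] with c hc
      simp [hc]
    rw [integral_congr_ae this]
    simp
  have h := hasSum_integral_of_summable_integral_norm
    (fun n : ℤ => (integrable_zpow_arcMeasure (-n)).mul_const (a n)) (by simpa only [hint] using ha)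
  refine h.unique ?_
  simp only [integral_mul_const, arcMeasure_integral_zpow, neg_eq_zero, ite_mul, one_mul, zero_mul]
  exact hasSum_ite_eq 0 (a 0) |>.congr_fun fun n => by split_ifs with hn <;> simp [hn]

theorem containsUpToDiscrete_of_summable {φ : Equiv.Perm 𝔻} {f : HardyTwo} {h : ℤ → HardyTwo}
    (hh : ∀ n z, h n z = f ((φ ^ n) z)) (hf : f ≠ 0) {R₁ R₂ : ℝ} (h0 : 0 < R₁) (h1 : R₁ < 1)
    (h2 : 1 < R₂) (hs : ∀ R, R₁ < R → R < R₂ → Summable fun n : ℤ => ‖h n‖ * R ^ (-n)) :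
    ContainsUpToDiscrete (restrictedPointSpectrum φ f) (annulus R₁ R₂) := by
  obtain ⟨z₀, hz₀⟩ : ∃ z₀ : 𝔻, f z₀ ≠ 0 := by
    by_contra! hall
    exact hf (HardyTwo.ext hall)
  set a : ℤ → ℂ := fun n => f ((φ ^ n) z₀) with ha
  have ha' : ∀ R, R₁ < R → R < R₂ → Summable fun n : ℤ => ‖a n‖ * R ^ (-n) := by
    intro R hR1 hR2
    have hR := h0.trans hR1
    refine Summable.of_nonneg_of_le (fun n => by positivity) (fun n => ?_)
      ((hs R hR1 hR2).mul_left ‖hardyEval z₀‖)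
    rw [← mul_assoc]
    gcongr
    exact norm_comp_zpow_le hh n z₀
  set G : ℂ → ℂ := fun c => ∑' n : ℤ, c ^ (-n) * a n with hG
  have hGd := (differentiableOn_laurentSeries h0 ha').analyticOnNhd (isOpen_annulus R₁ R₂)
  refine ⟨{c ∈ annulus R₁ R₂ | G c = 0}, sep_subset _ _, fun c hc hacc => ?_, ?_⟩
  · have hfr : ∃ᶠ w in 𝓝[≠] c, G w = 0 :=
      (accPt_iff_frequently_nhdsNE.1 hacc).mono fun w hw => hw.2
    have hzero := hGd.eqOn_zero_of_preconnected_of_frequently_eq_zero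
      (isPreconnected_annulus h0 (by linarith)) hc hfr
    have hint := integral_laurentSeries (a := a) (by simpa using ha' 1 h1 h2)
    have hae : ∀ᵐ w : ℂ ∂arcMeasure, ∑' n : ℤ, w ^ (-n) * a n = 0 := by
      filter_upwards [ae_norm_eq_one] with w hw
      exact hzero (show w ∈ annulus R₁ R₂ from ⟨by rwa [hw], by rwa [hw]⟩)
    rw [integral_congr_ae hae] at hint
    simp [ha] at hint
    exact hz₀ hint.symm
  · rintro c ⟨hc, hcE⟩
    have hc0 : c ≠ 0 := norm_pos_iff.1 (h0.trans hc.1)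
    refine mem_restrictedPointSpectrum_of_summable hh hc0 (Summable.of_norm ?_) z₀
      fun hG0 => hcE ⟨hc, hG0⟩
    refine (hs ‖c‖ hc.1 hc.2).congr fun n => ?_
    rw [norm_smul, norm_zpow, mul_comm]

theorem mem_restrictedPointSpectrum_of_tendsto {φ : Equiv.Perm 𝔻} {f : HardyTwo}
    {h : ℤ → HardyTwo} (hh : ∀ n z, h n z = f ((φ ^ n) z))
    (h0 : Tendsto (fun n => ‖h n‖) cofinite (𝓝 0)) {c : ℂ} (hc : ‖c‖ = 1) {N : ℕ → ℕ}
    (hN : Tendsto N atTop atTop) {F : HardyTwo} (hF0 : F ≠ 0)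
    (hF : Tendsto (fun j => ∑ n ∈ Finset.Icc (-(N j : ℤ)) (N j), c ^ n • h (-n)) atTop (𝓝 F)) :
    c ∈ restrictedPointSpectrum φ f := by
  have hc0 : c ≠ 0 := norm_pos_iff.1 (by rw [hc]; exact zero_lt_one)
  have happ : ∀ z, Tendsto (fun j => ∑ n ∈ Finset.Icc (-(N j : ℤ)) (N j),
      c ^ n * f ((φ ^ (-n)) z)) atTop (𝓝 (F z)) := by
    intro z
    have := ((hardyEval z).continuous.tendsto _).comp hF
    simpa only [Function.comp_def, map_sum, map_smul, hardyEval_apply, hh, smul_eq_mul] using this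
  refine ⟨F, ?_, hF0, fun z => ?_⟩
  · refine (Submodule.isClosed_topologicalClosure _).mem_of_tendsto hF
      (Eventually.of_forall fun j => Submodule.le_topologicalClosure _ ?_)
    exact Submodule.sum_mem _ fun n _ => Submodule.smul_mem _ _ (mem_doublyCyclic hh _)
  · set g : ℤ → ℂ := fun n => c ^ n * f ((φ ^ (-n)) z) with hg
    have hg0 : Tendsto g cofinite (𝓝 0) := by
      have h2 : Tendsto (fun n => ‖hardyEval z‖ * ‖h (-n)‖) cofinite (𝓝 0) := by
        have := (h0.comp (neg_injective (G := ℤ)).tendsto_cofinite).const_mul ‖hardyEval z‖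
        simpa only [Function.comp_def, mul_zero] using this
      refine squeeze_zero_norm (fun n => ?_) h2
      change ‖c ^ n * f ((φ ^ (-n)) z)‖ ≤ _
      rw [norm_mul, norm_zpow, hc, one_zpow, one_mul]
      exact norm_comp_zpow_le hh (-n) z
    have hNz : Tendsto (fun j => (N j : ℤ)) atTop cofinite :=
      (Nat.cast_injective.tendsto_cofinite.mono_left Nat.cofinite_eq_atTop.ge).comp hN
    have hneg : Tendsto (fun j => -(N j : ℤ) - 1) atTop cofinite := by
      have hinj : Function.Injective fun m : ℤ => -m - 1 := fun a b hab => by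
        simp only at hab
        omega
      exact hinj.tendsto_cofinite.comp hNz
    have hstep : ∀ j, ∑ n ∈ Finset.Icc (-(N j : ℤ)) (N j), c ^ n * f ((φ ^ (-n)) (φ z)) =
        c * (∑ n ∈ Finset.Icc (-(N j : ℤ)) (N j), g n + (g (-N j - 1) - g (N j))) := by
      intro j
      rw [← sum_Icc_neg_shift g, Finset.mul_sum]
      refine Finset.sum_congr rfl fun n _ => ?_
      change _ = c * (c ^ (n - 1) * f ((φ ^ (-(n - 1))) z))
      rw [zpow_apply_apply, ← mul_assoc, ← zpow_one_add₀ hc0]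
      congr 2
      · ring
      · congr 2
        ring
    have hlim := (((happ z).add ((hg0.comp hneg).sub (hg0.comp hNz))).const_mul c)
    simp only [sub_zero, add_zero] at hlim
    refine tendsto_nhds_unique (happ (φ z)) (hlim.congr fun j => ?_)
    rw [hstep]
    rfl

theorem exists_subset_restrictedPointSpectrum {φ : Equiv.Perm 𝔻} {f : HardyTwo} {h : ℤ → HardyTwo}
    (hh : ∀ n z, h n z = f ((φ ^ n) z)) (hf : f ≠ 0) (hs : Summable fun n => ‖h n‖ ^ 2) :
    ∃ T : Set ℂ, MeasurableSet T ∧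
      T ⊆ restrictedPointSpectrum φ f ∩ Metric.sphere 0 1 ∧ 0 < arcMeasure T := by
  choose k hk using fun n : ℤ => hardyOfSeq_surjective (h (-n))
  have hkn : ∀ n, ‖k n‖ = ‖h (-n)‖ := fun n => by rw [← hk, hardyOfSeq.norm_map]
  have hsk : Summable fun n => ‖k n‖ ^ 2 := by
    simp only [hkn]
    exact (Equiv.neg ℤ).summable_iff.2 hs
  have hk0 : k 0 ≠ 0 := by
    intro h0
    apply hf
    have h1 := hk 0
    rw [h0, map_zero, neg_zero] at h1
    refine HardyTwo.ext fun z => ?_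
    have := hh 0 z
    rw [← h1] at this
    simpa using this.symm
  have h1 : Tendsto (fun n => ‖h n‖) cofinite (𝓝 0) := by
    have := hs.tendsto_cofinite_zero.sqrt
    simpa [Real.sqrt_sq] using this
  obtain ⟨N, T, hN, hTm, hTs, hT0, hT⟩ := exists_measurableSet_tendsto_sum_zpow_smul hsk hk0
  refine ⟨T, hTm, fun c hc => ⟨?_, hTs hc⟩, hT0⟩
  obtain ⟨l, hl0, hl⟩ := hT c hc
  have hcn : ‖c‖ = 1 := by simpa using hTs hc
  have hF : Tendsto (fun j => ∑ n ∈ Finset.Icc (-(N j : ℤ)) (N j), c ^ n • h (-n)) atTop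
      (𝓝 (hardyOfSeq l)) := by
    have := (hardyOfSeq.continuous.tendsto l).comp hl
    simpa only [Function.comp_def, map_sum, map_smul, hk] using this
  exact mem_restrictedPointSpectrum_of_tendsto hh h1 hcn hN
    (fun h0 => hl0 (hardyOfSeq.injective (h0.trans (map_zero _).symm))) hF

/-! ### Norm estimates for the iterates -/

theorem exists_iterates {φ : Equiv.Perm 𝔻} {α β : ℂ} {μ : ℝ} (hφ : IsHyperbolicAut φ α β μ)
    (f : HardyTwo) (hfin : ∀ n : ℤ, hardyENorm 2 (fun z => f ((φ ^ n) z)) ^ 2 ≠ ∞) :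
    ∃ h : ℤ → HardyTwo, (∀ n z, h n z = f ((φ ^ n) z)) ∧
      ∀ n, ‖h n‖ₑ ^ 2 = hardyENorm 2 (fun z => f ((φ ^ n) z)) ^ 2 := by
  refine ⟨fun n => ⟨fun z => f ((φ ^ n) z), hφ.discHolo_comp_zpow n f.2.1, ?_⟩,
    fun n z => rfl, fun n => ?_⟩
  · rw [lt_top_iff_ne_top]
    intro htop
    apply hfin n
    rw [htop]
    simp
  · exact congrArg (· ^ 2) (HardyTwo.enorm_eq _)

theorem norm_sq_le_of_enorm_sq_le {E : Type*} [NormedAddCommGroup E] {x : E} {D : ℝ} (hD : 0 ≤ D)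
    {K : ℝ≥0∞} (hK : K ≠ ∞) (h : ‖x‖ₑ ^ 2 ≤ ENNReal.ofReal D * K) : ‖x‖ ^ 2 ≤ D * K.toReal := by
  have := ENNReal.toReal_mono (ENNReal.mul_ne_top ENNReal.ofReal_ne_top hK) h
  simpa [ENNReal.toReal_ofReal hD] using this

theorem summable_mul_zpow_of_two_sided {x : ℤ → ℝ} (hx : ∀ n, 0 ≤ x n) {μ D₁ D₂ a b R : ℝ}
    (hμ : 1 < μ) (h₁ : ∀ n : ℤ, x n ^ 2 ≤ D₁ * (μ ^ n) ^ (-(2 * a)))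
    (h₂ : ∀ n : ℤ, x n ^ 2 ≤ D₂ * (μ ^ n) ^ (2 * b)) (hR₁ : μ ^ (-a) < R) (hR₂ : R < μ ^ b) :
    Summable fun n : ℤ => x n * R ^ (-n) := by
  have hμ0 : 0 < μ := by linarith
  have hR : 0 < R := (Real.rpow_pos_of_pos hμ0 _).trans hR₁
  have key : ∀ (D c : ℝ) (n : ℤ), x n ^ 2 ≤ D * (μ ^ n) ^ (2 * c) → x n ≤ √D * (μ ^ c) ^ n := by
    intro D c n h
    have hp : (0 : ℝ) < (μ ^ c) ^ n := zpow_pos (Real.rpow_pos_of_pos hμ0 c) n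
    have he : (μ ^ n) ^ (2 * c) = ((μ ^ c) ^ n) ^ 2 := by
      rw [← Real.rpow_intCast μ n, ← Real.rpow_intCast (μ ^ c) n, ← Real.rpow_mul hμ0.le,
        ← Real.rpow_mul hμ0.le, ← Real.rpow_natCast, ← Real.rpow_mul hμ0.le]
      congr 1
      push_cast
      ring
    rw [he] at h
    calc x n = √(x n ^ 2) := (Real.sqrt_sq (hx n)).symm
      _ ≤ √(D * ((μ ^ c) ^ n) ^ 2) := Real.sqrt_le_sqrt h
      _ = √D * (μ ^ c) ^ n := by rw [Real.sqrt_mul' _ (sq_nonneg _), Real.sqrt_sq hp.le]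
  have hb : 0 < μ ^ b := Real.rpow_pos_of_pos hμ0 b
  have ha : 0 < μ ^ (-a) := Real.rpow_pos_of_pos hμ0 (-a)
  refine Summable.of_nat_of_neg ?_ ?_
  · refine Summable.of_nonneg_of_le (fun n => mul_nonneg (hx _) (zpow_pos hR _).le) (fun n => ?_)
      ((summable_geometric_of_lt_one (r := μ ^ (-a) / R) (by positivity)
        ((div_lt_one hR).2 hR₁)).mul_left √D₁)
    have h := key D₁ (-a) n (by rw [mul_neg]; exact h₁ n)
    rw [zpow_natCast] at h
    calc x n * R ^ (-(n : ℤ)) ≤ √D₁ * (μ ^ (-a)) ^ n * R ^ (-(n : ℤ)) := by gcongr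
      _ = √D₁ * (μ ^ (-a) / R) ^ n := by
        rw [zpow_neg, zpow_natCast, div_pow, div_eq_mul_inv, mul_assoc]
  · refine Summable.of_nonneg_of_le (fun n => mul_nonneg (hx _) (zpow_pos hR _).le) (fun n => ?_)
      ((summable_geometric_of_lt_one (r := R / μ ^ b) (by positivity)
        ((div_lt_one hb).2 hR₂)).mul_left √D₂)
    have h := key D₂ b (-n) (h₂ _)
    rw [zpow_neg, zpow_natCast] at h
    rw [neg_neg, zpow_natCast]
    calc x (-n) * R ^ n ≤ √D₂ * ((μ ^ b) ^ n)⁻¹ * R ^ n := by gcongr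
      _ = √D₂ * (R / μ ^ b) ^ n := by
        rw [div_pow]
        ring

theorem lintegral_weight_le {w : ℂ → ℝ} {D : ℝ} (hw : ∀ ζ : ℂ, ‖ζ‖ = 1 → w ζ ≤ D) (g : 𝔻 → ℂ)
    {r : ℝ} (hr : r ∈ Ico (0 : ℝ) 1) :
    ∫⁻ ζ : ℂ, ENNReal.ofReal (w ζ) * ‖discExt g (r * ζ)‖ₑ ^ 2 ∂arcMeasure ≤
      ENNReal.ofReal D * hardyENorm 2 g ^ 2 := by
  calc ∫⁻ ζ : ℂ, ENNReal.ofReal (w ζ) * ‖discExt g (r * ζ)‖ₑ ^ 2 ∂arcMeasure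
      ≤ ∫⁻ ζ : ℂ, ENNReal.ofReal D * ‖discExt g (r * ζ)‖ₑ ^ 2 ∂arcMeasure := by
        refine lintegral_mono_ae ?_
        filter_upwards [ae_norm_eq_one] with ζ hζ
        gcongr
        exact hw ζ hζ
    _ = ENNReal.ofReal D * ∫⁻ ζ : ℂ, ‖discExt g (r * ζ)‖ₑ ^ 2 ∂arcMeasure :=
        lintegral_const_mul' _ _ ENNReal.ofReal_ne_top
    _ ≤ _ := by
        gcongr
        exact lintegral_le_hardyENorm_sq g hr

theorem ae_ne_on_circle {a : ℂ} (ha : ‖a‖ = 1) : ∀ᵐ ζ : ℂ ∂arcMeasure, ζ ≠ a := by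
  have hm : MeasurableSet {ζ : ℂ | ¬ζ ≠ a} := by simp
  rw [ae_iff, ← lintegral_indicator_one hm,
    arcMeasure_lintegral_eq_param ha (measurable_one.indicator hm)]
  have h : ∀ x : ℝ, circleParam a x ∉ {ζ : ℂ | ¬ζ ≠ a} := by
    intro x hx
    have h1 := circleParam_sub_self a x
    rw [not_not.1 hx, sub_self] at h1
    have ha0 : a ≠ 0 := norm_pos_iff.1 (by rw [ha]; exact one_pos)
    exact div_ne_zero (by simp [ha0]) (one_sub_mul_I_ne_zero x) h1.symm
  refine (lintegral_congr fun x => ?_).trans lintegral_zero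
  rw [indicator_of_notMem (h x), mul_zero]

theorem lintegral_norm_sub_rpow_neg_ne_top {a : ℂ} (ha : ‖a‖ = 1) {κ : ℝ} (hκ : κ < 1) :
    ∫⁻ ζ : ℂ, ENNReal.ofReal (‖ζ - a‖ ^ (-κ)) ∂arcMeasure ≠ ∞ := by
  have hm : Measurable fun ζ : ℂ => ENNReal.ofReal (‖ζ - a‖ ^ (-κ)) := by fun_prop
  rw [arcMeasure_lintegral_eq_param ha hm]
  have hint : Integrable (fun x : ℝ => (1 + ‖x‖ ^ 2) ^ (-(2 - κ) / 2)) volume :=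
    integrable_rpow_neg_one_add_norm_sq (by simp; linarith)
  have h : ∀ x : ℝ, ENNReal.ofReal (1 / (Real.pi * (1 + x ^ 2))) *
      ENNReal.ofReal (‖circleParam a x - a‖ ^ (-κ)) =
      ENNReal.ofReal (Real.pi⁻¹ * 2 ^ (-κ)) *
        ENNReal.ofReal ((1 + ‖x‖ ^ 2) ^ (-(2 - κ) / 2)) := by
    intro x
    have hpi := Real.pi_pos
    have hx : (0 : ℝ) < 1 + x ^ 2 := by positivity
    rw [← ENNReal.ofReal_mul (by positivity), ← ENNReal.ofReal_mul (by positivity)]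
    congr 1
    have hn : ‖(1 - x * Complex.I : ℂ)‖ = (1 + x ^ 2) ^ (1 / 2 : ℝ) := by
      rw [← Real.sqrt_eq_rpow, ← norm_sq_one_sub_mul_I, Real.sqrt_sq (norm_nonneg _)]
    rw [circleParam_sub_self, norm_div, hn, norm_mul, ha, norm_neg, RCLike.norm_ofNat, mul_one,
      Real.div_rpow two_pos.le (by positivity), ← Real.rpow_mul hx.le, Real.norm_eq_abs, sq_abs,
      show -(2 - κ) / 2 = -1 - (1 / 2 * -κ) by ring, Real.rpow_sub hx, Real.rpow_neg_one]
    field_simp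
  simp only [h]
  rw [lintegral_const_mul' _ _ ENNReal.ofReal_ne_top]
  exact ENNReal.mul_ne_top ENNReal.ofReal_ne_top hint.lintegral_lt_top.ne

/-- Hölder's inequality for a function in `H^p`, `p > 2`, with a power weight. -/
theorem exists_lintegral_rpow_neg_mul_le {a : ℂ} (ha : ‖a‖ = 1) {p τ : ℝ} (hp : 2 < p)
    (hτ : τ < 1 - 2 / p) {g : 𝔻 → ℂ} (hg : MemHardy (ENNReal.ofReal p) g) :
    ∃ K : ℝ≥0∞, K ≠ ∞ ∧ ∀ r ∈ Ico (0 : ℝ) 1,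
      ∫⁻ ζ : ℂ, ENNReal.ofReal (‖ζ - a‖ ^ (-τ)) * ‖discExt g (r * ζ)‖ₑ ^ 2 ∂arcMeasure ≤ K := by
  have hp0 : 0 < p := by linarith
  have hpos : 0 < 1 - 2 / p := by
    rw [sub_pos, div_lt_one hp0]
    exact hp
  set q : ℝ := (1 - 2 / p)⁻¹ with hq
  have hq0 : 0 < q := by positivity
  have hpq : q.HolderConjugate (p / 2) := by
    refine ⟨?_, hq0, by positivity⟩
    rw [hq, inv_inv, inv_div, inv_one]
    ring
  have hI := lintegral_norm_sub_rpow_neg_ne_top ha (κ := τ * q) (by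
    rw [hq, ← div_eq_mul_inv, div_lt_one hpos]
    exact hτ)
  refine ⟨(∫⁻ ζ : ℂ, ENNReal.ofReal (‖ζ - a‖ ^ (-(τ * q))) ∂arcMeasure) ^ (1 / q) *
    hardyENorm (ENNReal.ofReal p) g ^ 2, ENNReal.mul_ne_top
      (ENNReal.rpow_ne_top_of_nonneg (by positivity) hI) (ENNReal.pow_ne_top hg.2.ne),
    fun r hr => ?_⟩
  have hm : Measurable fun ζ : ℂ => ENNReal.ofReal (‖ζ - a‖ ^ (-τ)) := by fun_prop
  have hgm := (hg.1.stronglyMeasurable r).measurable.enorm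
  refine (ENNReal.lintegral_mul_le_Lp_mul_Lq arcMeasure hpq hm.aemeasurable
    (hgm.pow_const 2).aemeasurable).trans ?_
  refine mul_le_mul' (le_of_eq ?_) ?_
  · congr 1
    refine lintegral_congr fun ζ => ?_
    rw [ENNReal.ofReal_rpow_of_nonneg (by positivity) hq0.le, ← Real.rpow_mul (norm_nonneg _),
      neg_mul]
  · have h1 : (∫⁻ ζ : ℂ, (‖discExt g (r * ζ)‖ₑ ^ 2) ^ (p / 2) ∂arcMeasure) ^ (1 / (p / 2)) =
        eLpNorm (fun ζ : ℂ => discExt g ((r : ℂ) * ζ)) (ENNReal.ofReal p) arcMeasure ^ 2 := by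
      rw [eLpNorm_eq_lintegral_rpow_enorm_toReal (by simpa using hp0) ENNReal.ofReal_ne_top,
        ENNReal.toReal_ofReal hp0.le, ← ENNReal.rpow_natCast _ 2, ← ENNReal.rpow_mul]
      congr 1
      · refine lintegral_congr fun ζ => ?_
        rw [← ENNReal.rpow_natCast, ← ENNReal.rpow_mul]
        congr 1
        push_cast
        field_simp
      · push_cast
        field_simp
    rw [h1]
    gcongr
    exact le_iSup₂ (f := fun (r : ℝ) (_ : r ∈ Ico (0 : ℝ) 1) =>
      eLpNorm (fun ζ : ℂ => discExt g ((r : ℂ) * ζ)) (ENNReal.ofReal p) arcMeasure) r hr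

theorem MemPowHardy.exists_factor {p : ℝ≥0∞} {α β : ℂ} {s t : ℝ} {f : 𝔻 → ℂ}
    (hf : MemPowHardy p α β s t f) : ∃ Q g : 𝔻 → ℂ, DiscHolo Q ∧ MemHardy p g ∧
      (∀ z, f z = Q z * g z) ∧
      ∀ z : 𝔻, ‖Q z‖ ^ 2 = ‖(z : ℂ) - α‖ ^ (2 * s) * ‖(z : ℂ) - β‖ ^ (2 * t) := by
  obtain ⟨A, B, g, hA, hB, hg, hfg⟩ := hf
  have hexp : ∀ {a : ℂ} {L : 𝔻 → ℂ} (u : ℝ), IsLogBranch a L →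
      (DiscHolo fun z => Complex.exp (u * L z)) ∧
        ∀ z : 𝔻, ‖Complex.exp (u * L z)‖ ^ 2 = ‖(z : ℂ) - a‖ ^ (2 * u) := by
    intro a L u hL
    refine ⟨DiscHolo.of_eq (F := fun z => Complex.exp (u * discExt L z))
      (DifferentiableOn.cexp (DifferentiableOn.const_mul hL.1 _))
      fun z => by rw [discExt_coe], fun z => ?_⟩
    rw [← hL.2, Complex.norm_exp, Complex.norm_exp, ← Real.exp_mul, ← Real.exp_nat_mul,
      Complex.re_ofReal_mul]
    congr 1
    push_cast
    ring
  refine ⟨fun z => Complex.exp (s * A z) * Complex.exp (t * B z), g,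
    (hexp s hA).1.mul (hexp t hB).1, hg, hfg, fun z => ?_⟩
  rw [norm_mul, mul_pow, (hexp s hA).2, (hexp t hB).2]

theorem MemSqrtHardy.exists_factor {p : ℝ≥0∞} {α β : ℂ} {f : 𝔻 → ℂ}
    (hf : MemSqrtHardy p α β f) : ∃ Q g : 𝔻 → ℂ, DiscHolo Q ∧ MemHardy p g ∧
      (∀ z, f z = Q z * g z) ∧ ∀ z : 𝔻, ‖Q z‖ ^ 2 = ‖(z : ℂ) - α‖ * ‖(z : ℂ) - β‖ := by
  obtain ⟨q, g, hq, hq2, hg, hfg⟩ := hf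
  exact ⟨q, g, hq, hg, hfg, fun z => by rw [← norm_pow, hq2, norm_mul]⟩

theorem norm_sub_le_two {a ζ : ℂ} (ha : ‖a‖ = 1) (hζ : ‖ζ‖ = 1) : ‖ζ - a‖ ≤ 2 := by
  refine (norm_sub_le _ _).trans ?_
  rw [ha, hζ]
  norm_num

theorem norm_sub_rpow_le_two {a ζ : ℂ} (ha : ‖a‖ = 1) (hζ : ‖ζ‖ = 1) {τ : ℝ} (h0 : 0 ≤ τ)
    (h1 : τ ≤ 1) : ‖ζ - a‖ ^ τ ≤ 2 :=
  calc ‖ζ - a‖ ^ τ ≤ 2 ^ τ := Real.rpow_le_rpow (norm_nonneg _) (norm_sub_le_two ha hζ) h0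
    _ ≤ 2 ^ (1 : ℝ) := Real.rpow_le_rpow_of_exponent_le one_le_two h1
    _ = 2 := Real.rpow_one 2

theorem liminf_le_of_forall_le {u : ℕ → ℝ≥0∞} {K : ℝ≥0∞} (h : ∀ k, u k ≤ K) :
    liminf u atTop ≤ K := by
  refine (liminf_le_liminf (Eventually.of_forall h)).trans ?_
  simp

namespace IsHyperbolicAut

variable {φ : Equiv.Perm 𝔻} {α β : ℂ} {μ : ℝ}

theorem containsUpToDiscrete_of_memPowHardy (hφ : IsHyperbolicAut φ α β μ) {ε δ : ℝ} (hε : 0 < ε)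
    (hε' : ε < 1 / 2) (hδ : 0 < δ) (hδ' : δ < 1 / 2) {f : HardyTwo} (hf : f ≠ 0)
    (hfm : MemPowHardy 2 α β (1 / 2 + ε) (1 / 2 + δ) f) :
    ContainsUpToDiscrete (restrictedPointSpectrum φ f) (annulus (μ ^ (-ε)) (μ ^ δ)) := by
  have hα := hφ.norm_attractive
  have hβ := hφ.norm_repulsive
  have hμ := hφ.one_lt_multiplier
  have hμ0 := hφ.multiplier_pos
  obtain ⟨Q, g, hQ, hg, hfg, hQn⟩ := hfm.exists_factor
  obtain ⟨C, hC, hJ⟩ := exists_mul_hypJac_le_rpow hα hβ hφ.fixed_ne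
  set ω : ℂ → ℝ := fun z => ‖z - α‖ ^ (2 * (1 / 2 + ε)) * ‖z - β‖ ^ (2 * (1 / 2 + δ)) with hω
  have hωc : Continuous ω :=
    ((continuous_id.sub continuous_const).norm.rpow_const fun _ => Or.inr (by linarith)).mul
      ((continuous_id.sub continuous_const).norm.rpow_const fun _ => Or.inr (by linarith))
  have hω0 : ∀ z, 0 ≤ ω z := fun z => by positivity
  have hωe : ∀ ζ s, ω ζ * hypJac α β s ζ =
      ‖ζ - α‖ * ‖ζ - β‖ * hypJac α β s ζ * ‖ζ - α‖ ^ (2 * ε) * ‖ζ - β‖ ^ (2 * δ) := by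
    intro ζ s
    have h1 : ∀ u : ℝ, 2 * (1 / 2 + u) = 1 + 2 * u := fun u => by ring
    simp only [hω, h1]
    rw [Real.rpow_one_add' (norm_nonneg _) (by linarith),
      Real.rpow_one_add' (norm_nonneg _) (by linarith)]
    ring
  have hw₁ : ∀ n : ℤ, ∀ ζ : ℂ, ‖ζ‖ = 1 →
      ω ζ * hypJac α β (μ ^ n) ζ ≤ 4 * C * (μ ^ n) ^ (-(2 * ε)) := by
    intro n ζ hζ
    have hs := zpow_pos hμ0 n
    rw [hωe]
    calc _ ≤ C * ((μ ^ n) ^ (-(2 * ε)) * ‖ζ - β‖ ^ (2 * ε)) * ‖ζ - β‖ ^ (2 * δ) := by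
          exact mul_le_mul_of_nonneg_right
            (hJ ζ hζ _ hs (2 * ε) (by linarith) (by linarith)).1 (by positivity)
      _ ≤ C * ((μ ^ n) ^ (-(2 * ε)) * 2) * 2 := by
          gcongr
          · exact norm_sub_rpow_le_two hβ hζ (by linarith) (by linarith)
          · exact norm_sub_rpow_le_two hβ hζ (by linarith) (by linarith)
      _ = _ := by ring
  have hw₂ : ∀ n : ℤ, ∀ ζ : ℂ, ‖ζ‖ = 1 →
      ω ζ * hypJac α β (μ ^ n) ζ ≤ 4 * C * (μ ^ n) ^ (2 * δ) := by
    intro n ζ hζ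
    have hs := zpow_pos hμ0 n
    rw [hωe, mul_right_comm]
    calc _ ≤ C * ((μ ^ n) ^ (2 * δ) * ‖ζ - α‖ ^ (2 * δ)) * ‖ζ - α‖ ^ (2 * ε) := by
          exact mul_le_mul_of_nonneg_right
            (hJ ζ hζ _ hs (2 * δ) (by linarith) (by linarith)).2 (by positivity)
      _ ≤ C * ((μ ^ n) ^ (2 * δ) * 2) * 2 := by
          gcongr
          · exact norm_sub_rpow_le_two hα hζ (by linarith) (by linarith)
          · exact norm_sub_rpow_le_two hα hζ (by linarith) (by linarith)
      _ = _ := by ring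
  have hbound : ∀ (n : ℤ) (D : ℝ), (∀ ζ : ℂ, ‖ζ‖ = 1 → ω ζ * hypJac α β (μ ^ n) ζ ≤ D) →
      hardyENorm 2 (fun z => f ((φ ^ n) z)) ^ 2 ≤ ENNReal.ofReal D * hardyENorm 2 g ^ 2 :=
    fun n D hD => (hφ.hardyENorm_comp_zpow_le hQ hg.1 hfg hωc hω0 hQn n).trans
      (liminf_le_of_forall_le fun k => lintegral_weight_le hD g (radius_mem k))
  have hK : hardyENorm 2 g ^ 2 ≠ ∞ := ENNReal.pow_ne_top hg.2.ne
  obtain ⟨h, hh, hn⟩ := exists_iterates hφ f fun n => ne_top_of_le_ne_top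
    (ENNReal.mul_ne_top ENNReal.ofReal_ne_top hK) (hbound n _ (hw₁ n))
  refine containsUpToDiscrete_of_summable hh hf (Real.rpow_pos_of_pos hμ0 _)
    (Real.rpow_lt_one_of_one_lt_of_neg hμ (by linarith)) (Real.one_lt_rpow hμ hδ)
    fun R hR₁ hR₂ => ?_
  refine summable_mul_zpow_of_two_sided (fun n => norm_nonneg _) hμ
    (D₁ := 4 * C * (hardyENorm 2 g ^ 2).toReal) (D₂ := 4 * C * (hardyENorm 2 g ^ 2).toReal)
    (fun n => ?_) (fun n => ?_) hR₁ hR₂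
  · have hs := zpow_pos hμ0 n
    rw [mul_right_comm]
    exact norm_sq_le_of_enorm_sq_le (by positivity) hK ((hn n).trans_le (hbound n _ (hw₁ n)))
  · have hs := zpow_pos hμ0 n
    rw [mul_right_comm]
    exact norm_sq_le_of_enorm_sq_le (by positivity) hK ((hn n).trans_le (hbound n _ (hw₂ n)))

theorem exists_subset_of_memSqrtHardy (hφ : IsHyperbolicAut φ α β μ) {f : HardyTwo} (hf : f ≠ 0)
    (hfm : MemSqrtHardy 2 α β f) : ∃ T : Set ℂ, MeasurableSet T ∧
      T ⊆ restrictedPointSpectrum φ f ∩ Metric.sphere 0 1 ∧ 0 < arcMeasure T := by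
  obtain ⟨Q, g, hQ, hg, hfg, hQn⟩ := hfm.exists_factor
  obtain ⟨C, hC⟩ := exists_tsum_mul_hypJac_le hφ.norm_attractive hφ.norm_repulsive hφ.fixed_ne
    hφ.one_lt_multiplier
  set ω : ℂ → ℝ := fun z => ‖z - α‖ * ‖z - β‖ with hω
  have hωc : Continuous ω := by fun_prop
  have hω0 : ∀ z, 0 ≤ ω z := fun z => by positivity
  set I : ℤ → ℕ → ℝ≥0∞ := fun n k => ∫⁻ ζ : ℂ, ENNReal.ofReal (ω ζ * hypJac α β (μ ^ n) ζ) *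
    ‖discExt g (radius k * ζ)‖ₑ ^ 2 ∂arcMeasure with hI
  have hbound : ∀ n, hardyENorm 2 (fun z => f ((φ ^ n) z)) ^ 2 ≤ liminf (I n) atTop :=
    fun n => hφ.hardyENorm_comp_zpow_le hQ hg.1 hfg hωc hω0 hQn n
  have hIsum : ∀ k, ∑' n, I n k ≤ ENNReal.ofReal C * hardyENorm 2 g ^ 2 := by
    intro k
    have hgm := ((hg.1.stronglyMeasurable (radius k)).measurable.enorm.pow_const 2)
    have hswap : ∑' n, I n k = ∫⁻ ζ : ℂ, ∑' n : ℤ, ENNReal.ofReal (ω ζ * hypJac α β (μ ^ n) ζ) *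
        ‖discExt g (radius k * ζ)‖ₑ ^ 2 ∂arcMeasure :=
      (lintegral_tsum fun n => (((hωc.measurable.mul
        (measurable_hypJac α β (μ ^ n))).ennreal_ofReal).mul hgm).aemeasurable).symm
    rw [hswap]
    calc ∫⁻ ζ : ℂ, ∑' n : ℤ, ENNReal.ofReal (ω ζ * hypJac α β (μ ^ n) ζ) *
          ‖discExt g (radius k * ζ)‖ₑ ^ 2 ∂arcMeasure
        ≤ ∫⁻ ζ : ℂ, ENNReal.ofReal C * ‖discExt g (radius k * ζ)‖ₑ ^ 2 ∂arcMeasure := by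
          refine lintegral_mono_ae ?_
          filter_upwards [ae_norm_eq_one] with ζ hζ
          rw [ENNReal.tsum_mul_right]
          gcongr
          exact hC ζ hζ
      _ = ENNReal.ofReal C * ∫⁻ ζ : ℂ, ‖discExt g (radius k * ζ)‖ₑ ^ 2 ∂arcMeasure :=
          lintegral_const_mul' _ _ ENNReal.ofReal_ne_top
      _ ≤ _ := by
          gcongr
          exact lintegral_le_hardyENorm_sq g (radius_mem k)
  have hsum : ∑' n : ℤ, hardyENorm 2 (fun z => f ((φ ^ n) z)) ^ 2 ≠ ∞ := by
    refine ne_top_of_le_ne_top (ENNReal.mul_ne_top (ENNReal.ofReal_ne_top (r := C))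
      (ENNReal.pow_ne_top (n := 2) hg.2.ne)) ?_
    calc ∑' n : ℤ, hardyENorm 2 (fun z => f ((φ ^ n) z)) ^ 2
        ≤ ∑' n, liminf (I n) atTop := ENNReal.tsum_le_tsum hbound
      _ = ∫⁻ n, liminf (fun k => I n k) atTop ∂Measure.count := (lintegral_count _).symm
      _ ≤ liminf (fun k => ∫⁻ n, I n k ∂Measure.count) atTop :=
          lintegral_liminf_le fun k => Measurable.of_discrete
      _ ≤ _ := liminf_le_of_forall_le fun k => by
          rw [lintegral_count]
          exact hIsum k
  obtain ⟨h, hh, hn⟩ := exists_iterates hφ f (ENNReal.ne_top_of_tsum_ne_top hsum)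
  refine exists_subset_restrictedPointSpectrum hh hf ?_
  have := ENNReal.summable_toReal hsum
  simp only [← hn] at this
  simpa using this

theorem exists_norm_sq_le_of_memSqrtHardy (hφ : IsHyperbolicAut φ α β μ) {p : ℝ} (hp : 2 < p)
    {f : HardyTwo} (hfm : MemSqrtHardy (ENNReal.ofReal p) α β f) {τ : ℝ} (h0 : 0 ≤ τ)
    (hτ : τ < 1 - 2 / p) : ∃ (D : ℝ) (K : ℝ≥0∞), 0 ≤ D ∧ K ≠ ∞ ∧ ∀ n : ℤ,
      hardyENorm 2 (fun z => f ((φ ^ n) z)) ^ 2 ≤ ENNReal.ofReal (D * (μ ^ n) ^ (-τ)) * K ∧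
      hardyENorm 2 (fun z => f ((φ ^ n) z)) ^ 2 ≤ ENNReal.ofReal (D * (μ ^ n) ^ τ) * K := by
  have hα := hφ.norm_attractive
  have hβ := hφ.norm_repulsive
  have hμ0 := hφ.multiplier_pos
  have hτ1 : τ ≤ 1 := by
    have : 0 < 2 / p := by positivity
    linarith
  obtain ⟨Q, g, hQ, hg, hfg, hQn⟩ := hfm.exists_factor
  obtain ⟨C, hC, hJ⟩ := exists_mul_hypJac_le_rpow hα hβ hφ.fixed_ne
  obtain ⟨K₁, hK₁, hg₁⟩ := exists_lintegral_rpow_neg_mul_le hα hp hτ hg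
  obtain ⟨K₂, hK₂, hg₂⟩ := exists_lintegral_rpow_neg_mul_le hβ hp hτ hg
  set ω : ℂ → ℝ := fun z => ‖z - α‖ * ‖z - β‖ with hω
  have hωc : Continuous ω := by fun_prop
  have hω0 : ∀ z, 0 ≤ ω z := fun z => by positivity
  have key : ∀ (a : ℂ) (K : ℝ≥0∞) (x : ℝ) (n : ℤ), ‖a‖ = 1 → 0 ≤ x → (∀ r ∈ Ico (0 : ℝ) 1,
      ∫⁻ ζ : ℂ, ENNReal.ofReal (‖ζ - a‖ ^ (-τ)) * ‖discExt g (r * ζ)‖ₑ ^ 2 ∂arcMeasure ≤ K) →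
      (∀ ζ : ℂ, ‖ζ‖ = 1 → ω ζ * hypJac α β (μ ^ n) ζ * ‖ζ - a‖ ^ τ ≤ x) →
      hardyENorm 2 (fun z => f ((φ ^ n) z)) ^ 2 ≤ ENNReal.ofReal x * K := by
    intro a K x n ha hx hK hw
    refine (hφ.hardyENorm_comp_zpow_le hQ hg.1 hfg hωc hω0 hQn n).trans
      (liminf_le_of_forall_le fun k => ?_)
    calc ∫⁻ ζ : ℂ, ENNReal.ofReal (ω ζ * hypJac α β (μ ^ n) ζ) *
          ‖discExt g (radius k * ζ)‖ₑ ^ 2 ∂arcMeasure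
        ≤ ∫⁻ ζ : ℂ, ENNReal.ofReal x * (ENNReal.ofReal (‖ζ - a‖ ^ (-τ)) *
          ‖discExt g (radius k * ζ)‖ₑ ^ 2) ∂arcMeasure := by
          refine lintegral_mono_ae ?_
          filter_upwards [ae_norm_eq_one, ae_ne_on_circle ha] with ζ hζ hζa
          rw [← mul_assoc, ← ENNReal.ofReal_mul hx]
          gcongr ENNReal.ofReal ?_ * _
          have hpos : 0 < ‖ζ - a‖ ^ τ :=
            Real.rpow_pos_of_pos (norm_pos_iff.2 (sub_ne_zero.2 hζa)) τ
          rw [Real.rpow_neg (norm_nonneg _), ← div_eq_mul_inv, le_div_iff₀ hpos]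
          exact hw ζ hζ
      _ = ENNReal.ofReal x * ∫⁻ ζ : ℂ, ENNReal.ofReal (‖ζ - a‖ ^ (-τ)) *
          ‖discExt g (radius k * ζ)‖ₑ ^ 2 ∂arcMeasure :=
          lintegral_const_mul' _ _ ENNReal.ofReal_ne_top
      _ ≤ _ := by
          gcongr
          exact hK _ (radius_mem k)
  refine ⟨2 * C, max K₁ K₂, by positivity, by simp [hK₁, hK₂], fun n => ?_⟩
  have hs := zpow_pos hμ0 n
  constructor
  · refine key α _ _ n hα (by positivity) (fun r hr => (hg₁ r hr).trans (le_max_left _ _))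
      fun ζ hζ => (hJ ζ hζ _ hs τ h0 hτ1).1.trans ?_
    calc C * ((μ ^ n) ^ (-τ) * ‖ζ - β‖ ^ τ) ≤ C * ((μ ^ n) ^ (-τ) * 2) := by
          gcongr
          exact norm_sub_rpow_le_two hβ hζ h0 hτ1
      _ = _ := by ring
  · refine key β _ _ n hβ (by positivity) (fun r hr => (hg₂ r hr).trans (le_max_right _ _))
      fun ζ hζ => (hJ ζ hζ _ hs τ h0 hτ1).2.trans ?_
    calc C * ((μ ^ n) ^ τ * ‖ζ - α‖ ^ τ) ≤ C * ((μ ^ n) ^ τ * 2) := by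
          gcongr
          exact norm_sub_rpow_le_two hα hζ h0 hτ1
      _ = _ := by ring

theorem containsUpToDiscrete_of_memSqrtHardy (hφ : IsHyperbolicAut φ α β μ) {p : ℝ} (hp : 2 < p)
    {f : HardyTwo} (hf : f ≠ 0) (hfm : MemSqrtHardy (ENNReal.ofReal p) α β f) :
    ContainsUpToDiscrete (restrictedPointSpectrum φ f)
      (annulus (μ ^ (-(1 / 2 - 1 / p))) (μ ^ (1 / 2 - 1 / p))) := by
  have hμ := hφ.one_lt_multiplier
  have hμ0 := hφ.multiplier_pos
  have hp0 : 0 < p := by linarith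
  have hlog : 0 < Real.log μ := Real.log_pos hμ
  set ε : ℝ := 1 / 2 - 1 / p with hε
  have hε2 : 1 - 2 / p = 2 * ε := by rw [hε]; ring
  have hε0 : 0 < ε := by
    rw [hε, sub_pos]
    exact one_div_lt_one_div_of_lt two_pos hp
  obtain ⟨D₀, K₀, -, hK₀, hb₀⟩ := hφ.exists_norm_sq_le_of_memSqrtHardy hp hfm le_rfl
    (by linarith)
  obtain ⟨h, hh, hn⟩ := exists_iterates hφ f fun n => ne_top_of_le_ne_top
    (ENNReal.mul_ne_top ENNReal.ofReal_ne_top hK₀) (hb₀ n).1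
  refine containsUpToDiscrete_of_summable hh hf (Real.rpow_pos_of_pos hμ0 _)
    (Real.rpow_lt_one_of_one_lt_of_neg hμ (by linarith)) (Real.one_lt_rpow hμ hε0)
    fun R hR₁ hR₂ => ?_
  have hR : 0 < R := (Real.rpow_pos_of_pos hμ0 _).trans hR₁
  have hl₁ := Real.log_lt_log (Real.rpow_pos_of_pos hμ0 _) hR₁
  have hl₂ := Real.log_lt_log hR hR₂
  rw [Real.log_rpow hμ0] at hl₁ hl₂
  have hlt : |Real.log R| / Real.log μ < ε := by
    rw [div_lt_iff₀ hlog, abs_lt]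
    exact ⟨by linarith, hl₂⟩
  obtain ⟨η, hη₁, hη₂⟩ := exists_between hlt
  have hη0 : 0 ≤ η := le_trans (by positivity) hη₁.le
  rw [div_lt_iff₀ hlog, abs_lt] at hη₁
  obtain ⟨D, K, hD, hK, hb⟩ := hφ.exists_norm_sq_le_of_memSqrtHardy hp hfm
    (τ := 2 * η) (by linarith) (by linarith)
  refine summable_mul_zpow_of_two_sided (fun n => norm_nonneg _) hμ
    (D₁ := D * K.toReal) (D₂ := D * K.toReal) (a := η) (b := η)
    (fun n => ?_) (fun n => ?_) ?_ ?_
  · have hs := zpow_pos hμ0 n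
    rw [mul_right_comm]
    exact norm_sq_le_of_enorm_sq_le (by positivity) hK ((hn n).trans_le (hb n).1)
  · have hs := zpow_pos hμ0 n
    rw [mul_right_comm]
    exact norm_sq_le_of_enorm_sq_le (by positivity) hK ((hn n).trans_le (hb n).2)
  · rw [← Real.log_lt_log_iff (Real.rpow_pos_of_pos hμ0 _) hR, Real.log_rpow hμ0]
    linarith [hη₁.1]
  · rw [← Real.log_lt_log_iff hR (Real.rpow_pos_of_pos hμ0 _), Real.log_rpow hμ0]
    exact hη₁.2

end IsHyperbolicAut

theorem theorem4p1 (φ : Equiv.Perm 𝔻) (α β : ℂ) (μ : ℝ) (hφ : IsHyperbolicAut φ α β μ) :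
    (∀ ε δ : ℝ, 0 < ε → ε < 1 / 2 → 0 < δ → δ < 1 / 2 →
      ∀ f : HardyTwo, f ≠ 0 → MemPowHardy 2 α β (1 / 2 + ε) (1 / 2 + δ) f →
        ContainsUpToDiscrete (restrictedPointSpectrum φ f) (annulus (μ ^ (-ε)) (μ ^ δ))) ∧
    (∀ f : HardyTwo, f ≠ 0 → MemSqrtHardy 2 α β f →
      ∃ T : Set ℂ, MeasurableSet T ∧
        T ⊆ restrictedPointSpectrum φ f ∩ Metric.sphere 0 1 ∧ 0 < arcMeasure T) ∧
    (∀ p : ℝ, 2 < p →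
      ∀ f : HardyTwo, f ≠ 0 → MemSqrtHardy (ENNReal.ofReal p) α β f →
        ContainsUpToDiscrete (restrictedPointSpectrum φ f)
          (annulus (μ ^ (-(1 / 2 - 1 / p))) (μ ^ (1 / 2 - 1 / p)))) :=
  ⟨fun _ _ hε hε' hδ hδ' _ hf hfm => hφ.containsUpToDiscrete_of_memPowHardy hε hε' hδ hδ' hf hfm,
    fun _ hf hfm => hφ.exists_subset_of_memSqrtHardy hf hfm,
    fun _ hp _ hf hfm => hφ.containsUpToDiscrete_of_memSqrtHardy hp hf hfm⟩
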